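/- Conventions. A relational structure of signature $\mu=(n_i)_{i\in I}$ is $\mathcal R=(E,(\rho_i)_{i\in I})$ with $\rho_i\subseteq E^{n_i}$; its restriction to $A\subseteq E$ is $\mathcal R_{\restriction A}=(A,(\rho_i\cap A^{n_i})_{i\in I})$. Throughout, $\mu$ is finite ($I$ is finite) and its first relation is binary; $\mathcal R$ is *ordered* if its first relation is a linear order $\le$ on $E$. $\mathcal R$ *embeds* in $\mathcal R'$ if $\mathcal R$ is isomorphic to a restriction of $\mathcal R'$; two structures are *incomparable* if neither embeds in the other. A *local isomorphism* of $\mathcal R$ is an isomorphism between two restrictions of $\mathcal R$. A *monomorphic interval* of an ordered structure $\mathcal R$ is an interval $A$ of the chain $(E,\le)$ such that, for all finite $F,F'\subseteq E$ with $|F|=|F'|$ and $F\setminus A=F'\setminus A$, the restrictions $\mathcal R_{\restriction F}$ and $\mathcal R_{\restriction F'}$ are isomorphic. An *interval decomposition* of $\mathcal R$ is a partition of $E$ into monomorphic intervals; it is *finite* if it has finitely many blocks. Let $\mathcal D_\mu$ be the class of ordered structures of signature $\mu$ that have no finite interval decomposition. A structure is *almost multichainable* if it is isomorphic to a structure $\mathcal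 S$ on a disjoint union $F\cup(L\times K)$, with $F,K$ finite, for which there is a linear order on $L$ such that for every local isomorphism $h$ of the chain $L$, the map $(x,y)\mapsto(h(x),y)$ extended by the identity on $F$ is a local isomorphism of $\mathcal S$. For a class $\mathcal C$ of finite structures of signature $\mu$: $\mathcal C$ is *hereditary* if every structure that embeds in a member of $\mathcal C$ belongs to $\mathcal C$; its *profile* $\varphi_{\mathcal C}(n)$ is the number of members of $\mathcal C$ with $n$ elements, counted up to isomorphism. The *age* of $\mathcal R$ is the class of finite structures that embed in $\mathcal R$. **Theorem.** Let $\mu$ be a finite signature whose first relation is binary. There is a finite set $\mathfrak A\subseteq\mathcal D_\mu$ of pairwise incomparable almost multichainable structures such that every member of $\mathcal D_\mu$ embeds some member of $\mathfrak A$. Moreover, for this $\mathfrak A$ and for every hereditary class $\mathcal C$ of finite ordered structures of signature $\mu$, exactly one of the following holds: 1. there is an integer $\ell\ge 0$ such that every member of $\mathcal C$ has an interval decomposition with at most $\ell+1$ intervals; 2. $\mathcal C$ contains the age of some member of $\mathfrak A$. In case 1, for each such $\ell$, there is a polynomial $P\in\mathbb Q[X]$ of degree at most $\ell$ with $\varphi_{\mathcal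 C}(n)=P(n)$ for all sufficiently large $n$. -/

import Mathlib

open scoped FirstOrder

/-!
A signature is a relational first-order language `L`; it is finite when `L` has finitely many
relation symbols (`Finite (Σ n, L.Relations n)`). The binary symbol `leSymb` supplied by
`L.IsOrdered` is the distinguished first relation of an ordered structure. A relational structure
of signature `L` is an `L.Structure`, "embeds" is `↪[L]` and isomorphism is `≃[L]`.
-/

universe u v w

namespace OrderedStr

/-- The first relation of a structure whose signature has a distinguished binary symbol. -/
def Le (L : FirstOrder.Language.{u, v}) [L.IsOrdered] {M : Type w} [L.Structure M]
    (a b : M) : Prop :=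
  FirstOrder.Language.Structure.RelMap
    (FirstOrder.Language.leSymb : L.Relations 2) ![a, b]

/-- `M` is an ordered structure: its first relation is a linear order on the domain. -/
def IsOrdered (L : FirstOrder.Language.{u, v}) [L.IsOrdered] (M : Type w) [L.Structure M] : Prop :=
  IsLinearOrder M (Le L)

/-- The restriction of a relational structure to a subset of its domain. -/
def restr (L : FirstOrder.Language.{u, v}) [L.IsRelational] {M : Type w} [L.Structure M]
    (A : Set M) : L.Substructure M where
  carrier := A
  fun_mem f := isEmptyElim f

@[simp] theorem mem_restr (L : FirstOrder.Language.{u, v}) [L.IsRelational] {M : Type w}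
    [L.Structure M] (A : Set M) (a : M) : a ∈ restr L A ↔ a ∈ A :=
  Iff.rfl

/-- The restrictions of the structure to the subsets `A` and `B` are isomorphic. -/
def IsoRestr (L : FirstOrder.Language.{u, v}) [L.IsRelational] {M : Type w} [L.Structure M]
    (A B : Set M) : Prop :=
  Nonempty (restr L A ≃[L] restr L B)

/-- `A` is an interval of the chain `(M, ≤)`. -/
def IsInterval (L : FirstOrder.Language.{u, v}) [L.IsOrdered] {M : Type w} [L.Structure M]
    (A : Set M) : Prop :=
  ∀ a ∈ A, ∀ b ∈ A, ∀ c, Le L a c → Le L c b → c ∈ A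

/-- `A` is a monomorphic interval: an interval of the chain such that any two finite sets `F, F'`
of the same size with `F \ A = F' \ A` carry isomorphic restrictions. -/
def IsMonomorphicInterval (L : FirstOrder.Language.{u, v}) [L.IsRelational] [L.IsOrdered]
    {M : Type w} [L.Structure M] (A : Set M) : Prop :=
  IsInterval L A ∧
    ∀ F F' : Finset M, F.card = F'.card → (F : Set M) \ A = (F' : Set M) \ A →
      IsoRestr L (F : Set M) (F' : Set M)

/-- An interval decomposition: a partition of the domain into monomorphic intervals. -/
def IsIntervalDecomposition (L : FirstOrder.Language.{u, v}) [L.IsRelational] [L.IsOrdered]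
    {M : Type w} [L.Structure M] (P : Set (Set M)) : Prop :=
  Setoid.IsPartition P ∧ ∀ A ∈ P, IsMonomorphicInterval L A

/-- `M` has an interval decomposition with at most `k` intervals. -/
def HasIntervalDecompositionLE (L : FirstOrder.Language.{u, v}) [L.IsRelational] [L.IsOrdered]
    (M : Type w) [L.Structure M] (k : ℕ) : Prop :=
  ∃ P : Set (Set M), IsIntervalDecomposition L P ∧ P.encard ≤ k

/-- The class of the ordered structures of signature `L` that have no interval decomposition with
finitely many intervals. -/
def classD (L : FirstOrder.Language.{u, v}) [L.IsRelational] [L.IsOrdered] :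
    Set (CategoryTheory.Bundled.{w} L.Structure) :=
  {M | IsOrdered L M ∧ ¬ ∃ P : Set (Set M), IsIntervalDecomposition L P ∧ P.Finite}

/-- A structure on `F ⊕ (Λ × K)`, where `Λ` is a chain, is an almost multichain along `Λ` if for
every local isomorphism `h` of the chain `Λ` (an order isomorphism from a subset `D` onto a subset
`D'`) the map `(h, 1_K)`, extended by the identity on `F`, is a local isomorphism of the structure.
The two composites below are the inclusion of the domain `F ⊕ (D × K)` of that map
and the map itself. -/
def IsAlmostMultichain (L : FirstOrder.Language.{u, v}) (F K : Type) (Λ : Type w) [LinearOrder Λ]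
    [L.Structure (F ⊕ (Λ × K))] : Prop :=
  ∀ (D D' : Set Λ) (h : D ≃o D') (n : ℕ) (r : L.Relations n) (x : Fin n → F ⊕ (D × K)),
    FirstOrder.Language.Structure.RelMap r
        (fun i => Sum.map id (Prod.map (fun d : D => (d : Λ)) id) (x i)) ↔
      FirstOrder.Language.Structure.RelMap r
        (fun i => Sum.map id (Prod.map (fun d : D => (h d : Λ)) id) (x i))

/-- `M` is almost multichainable: isomorphic to an almost multichain on `F ⊕ (Λ × K)` with `F` and
`K` finite. -/
def IsAlmostMultichainable (L : FirstOrder.Language.{u, v}) (M : Type w) [L.Structure M] : Prop :=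
  ∃ (F K : Type) (_ : Finite F) (_ : Finite K) (Λ : Type w) (_ : LinearOrder Λ)
    (_ : L.Structure (F ⊕ (Λ × K))),
    IsAlmostMultichain L F K Λ ∧ Nonempty (M ≃[L] (F ⊕ (Λ × K)))

/-- The profile of a class `C`: the number of members of `C` with `n` elements, counted up to
isomorphism (over a finite signature there are finitely many). -/
noncomputable def profile {L : FirstOrder.Language.{u, v}}
    (C : Set (CategoryTheory.Bundled.{w} L.Structure)) (n : ℕ) : ℕ :=
  (Quotient.mk FirstOrder.Language.equivSetoid ''
    {M | M ∈ C ∧ Finite M ∧ Nat.card M = n}).ncard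

end OrderedStr

/-!
Let `m` bound the arities. Everything rests on the similarity relation `Sim` of an ordered
structure: `x` and `y` are similar if the interval between them is monomorphic. In terms of tuples,
a convex set is monomorphic if relations do not distinguish order-similar tuples that differ only
inside it (`isMonomorphicInterval_iff`). Two monomorphic intervals with a common end point have a
monomorphic union, because entries can be moved one at a time through that point
(`IsMono.Icc_union`). Hence similarity is an equivalence, and its classes form the coarsest interval
decomposition. Dissimilarity of two points is witnessed by two tuples of length at most `m`, a
quantifier-free condition on at most `2 + 2 * m` elements (`IsWit`).

A structure without finite interval decomposition therefore contains an infinite monotone chain of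
witnesses. Ramsey's theorem makes such a chain order-indiscernible, and an indiscernible sequence of
tuples spans an almost multichain over `ℕ` (`IsWitSeq.exists_template`). An almost multichain is
determined by finitely many values of its relations, so finitely many almost multichains suffice
(`finite_templates`), and the minimal ones under embeddability form the required set.

A hereditary class cannot both have bounded decompositions and contain the age of one of these
structures, since a long chain of witnesses lies in a finite substructure. If the decompositions are
unbounded, an ultraproduct of members with longer and longer chains of witnesses has an infinite
chain, and its age lies in the class (`exists_template_age_subset`).

For a class with decompositions into at most `ℓ + 1` blocks, every member is uniquely presented on a
chain of blocks that are its similarity classes. The presentation is determined by the sizes of the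
blocks and by its truncation to the first `2 * m + 1` positions of each block, which takes finitely
many values. For a given truncation, the admissible sizes are closed under decreasing a size as long
as the truncation is not affected, because the blocks remain distinct classes (`sim_iff_of_incl`).
By Dickson's lemma such a set of tuples has a generating function `p / (1 - x) ^ (ℓ + 1)`
(`exists_generatingFunction`), so its members are eventually counted by a polynomial of degree at
most `ℓ`, and the profile is a finite sum of such counts.
-/

namespace OrderedStr

open FirstOrder FirstOrder.Language FirstOrder.Language.Structure

/-! ### Order-similar tuples and Ramsey's theorem -/

/-- Two tuples are order-similar if their entries are compared in the same way; in linear orders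
this says that `x i ↦ y i` is a well-defined isomorphism between the ranges. -/
def OrdSim {ι α β : Type*} [LE α] [LE β] (x : ι → α) (y : ι → β) : Prop :=
  ∀ i j, x i ≤ x j ↔ y i ≤ y j

namespace OrdSim

variable {ι κ α β γ : Type*}

theorem rfl' [LE α] (x : ι → α) : OrdSim x x := fun _ _ => Iff.rfl

theorem symm [LE α] [LE β] {x : ι → α} {y : ι → β} (h : OrdSim x y) : OrdSim y x :=
  fun i j => (h i j).symm

theorem trans [LE α] [LE β] [LE γ] {x : ι → α} {y : ι → β} {z : ι → γ} (h : OrdSim x y)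
    (h' : OrdSim y z) : OrdSim x z :=
  fun i j => (h i j).trans (h' i j)

theorem of_strictMono [LinearOrder α] [Preorder β] {f : α → β} (hf : StrictMono f) (x : ι → α) :
    OrdSim x (f ∘ x) :=
  fun _ _ => hf.le_iff_le.symm

theorem eq_iff [PartialOrder α] [PartialOrder β] {x : ι → α} {y : ι → β} (h : OrdSim x y)
    (i j : ι) : x i = x j ↔ y i = y j := by
  simp only [le_antisymm_iff, h i j, h j i]

theorem lt_iff [LinearOrder α] [LinearOrder β] {x : ι → α} {y : ι → β} (h : OrdSim x y)
    (i j : ι) : x i < x j ↔ y i < y j := by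
  simp only [← not_le, h j i]

end OrdSim

/-- The infinite Ramsey theorem for colourings of increasing `p`-tuples of natural numbers. -/
theorem exists_strictMono_homogeneous {κ : Type*} [Finite κ] (p : ℕ) (c : (Fin p → ℕ) → κ) :
    ∃ φ : ℕ → ℕ, StrictMono φ ∧ ∃ k, ∀ t : Fin p → ℕ, StrictMono t → c (φ ∘ t) = k := by
  induction p with
  | zero => exact ⟨id, strictMono_id, c ![], fun t _ => congrArg c (Subsingleton.elim _ _)⟩
  | succ p ih =>
    -- One step: thin out `ψ` beyond its first value `ψ 0`, so that the colour of a tuple starting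
    -- with `ψ 0` and continued in the thinned sequence does not depend on the continuation.
    have step : ∀ ψ : {ψ : ℕ → ℕ // StrictMono ψ}, ∃ φ : {φ : ℕ → ℕ // StrictMono φ}, ∃ k,
        ∀ t : Fin p → ℕ, StrictMono t →
          c (Fin.cons (ψ.1 0) (fun j => ψ.1 (φ.1 (t j) + 1))) = k := by
      intro ψ
      obtain ⟨φ, hφ, k, hk⟩ := ih (fun t => c (Fin.cons (ψ.1 0) (fun j => ψ.1 (t j + 1))))
      exact ⟨⟨φ, hφ⟩, k, hk⟩
    choose F K hFK using step
    let nxt : {ψ : ℕ → ℕ // StrictMono ψ} → {ψ : ℕ → ℕ // StrictMono ψ} := fun ψ =>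
      ⟨fun n => ψ.1 ((F ψ).1 n + 1), fun a b h => ψ.2 (Nat.succ_lt_succ ((F ψ).2 h))⟩
    let Ψ : ℕ → {ψ : ℕ → ℕ // StrictMono ψ} := fun i => nxt^[i] ⟨id, strictMono_id⟩
    have hΨ : ∀ i, Ψ (i + 1) = nxt (Ψ i) := fun i => Function.iterate_succ_apply' _ _ _
    have hsub : ∀ i d, ∀ n, ∃ n', (Ψ (i + d)).1 n = (Ψ i).1 n' := by
      intro i d
      induction d with
      | zero => exact fun n => ⟨n, rfl⟩
      | succ d ihd =>
        intro n
        obtain ⟨n', h'⟩ := ihd ((F (Ψ (i + d))).1 n + 1)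
        refine ⟨n', ?_⟩
        rw [← h', ← add_assoc, hΨ]
    let a : ℕ → ℕ := fun i => (Ψ i).1 0
    have hmem : ∀ i j, i < j → ∃ n', a j = (Ψ (i + 1)).1 n' := by
      intro i j hij
      obtain ⟨d, rfl⟩ := Nat.exists_eq_add_of_lt hij
      have := hsub (i + 1) d 0
      rwa [show i + 1 + d = i + d + 1 by omega] at this
    have ha : StrictMono a := by
      refine strictMono_nat_of_lt_succ fun i => ?_
      change (Ψ i).1 0 < (Ψ (i + 1)).1 0
      rw [hΨ]
      exact (Ψ i).2 (Nat.succ_pos _)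
    obtain ⟨k, hk⟩ := Finite.exists_infinite_fiber (fun i => K (Ψ i))
    have hinf : {i | K (Ψ i) = k}.Infinite := Set.infinite_coe_iff.mp hk
    refine ⟨a ∘ Nat.nth (fun i => K (Ψ i) = k), ha.comp (Nat.nth_strictMono hinf), k, ?_⟩
    intro t ht
    set ν := Nat.nth (fun i => K (Ψ i) = k) with hν
    have hνm : StrictMono ν := Nat.nth_strictMono hinf
    choose g hg using hmem (ν (t 0))
    have hlt : ∀ j : Fin p, ν (t 0) < ν (t j.succ) := fun j => hνm (ht (Fin.succ_pos j))
    have hs : StrictMono fun j : Fin p => g (ν (t j.succ)) (hlt j) := by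
      intro j j' hjj
      rw [← (Ψ (ν (t 0) + 1)).2.lt_iff_lt, ← hg, ← hg]
      exact ha (hνm (ht (Fin.succ_lt_succ_iff.mpr hjj)))
    have := hFK (Ψ (ν (t 0))) _ hs
    rw [show K (Ψ (ν (t 0))) = k from Nat.nth_mem_of_infinite hinf _] at this
    rw [← this]
    congr 1
    funext j
    refine Fin.cases rfl (fun j => ?_) j
    simp only [Function.comp_apply, Fin.cons_succ]
    rw [hg _ (hlt j), hΨ]

/-- A tuple of natural numbers factors through an increasing tuple of the same length, via a map
that depends only on the order type of the tuple. -/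
theorem exists_rank_factorization {n : ℕ} (x y : Fin n → ℕ) (h : OrdSim x y) :
    ∃ (ρ : Fin n → Fin n) (t t' : Fin n → ℕ), StrictMono t ∧ StrictMono t' ∧
      x = t ∘ ρ ∧ y = t' ∘ ρ := by
  classical
  -- The increasing tuple lists the values of `x` and continues beyond all of them.
  let P : (Fin n → ℕ) → ℕ → Prop := fun x a => (∃ i, x i = a) ∨ ∀ i, x i < a
  have hP : ∀ x, {a | P x a}.Infinite := fun x => by
    refine Set.infinite_of_not_bddAbove fun ⟨b, hb⟩ => ?_
    have : P x (b + 1 + ∑ i, x i) := Or.inr fun i => by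
      have := Finset.single_le_sum (f := x) (fun _ _ => Nat.zero_le _) (Finset.mem_univ i)
      omega
    have := hb this
    omega
  have hcount : ∀ x : Fin n → ℕ, ∀ i, Nat.count (P x) (x i) =
      ((Finset.univ.filter fun j => x j < x i).image x).card := by
    intro x i
    rw [Nat.count_eq_card_filter_range]
    congr 1
    ext a
    simp only [Finset.mem_filter, Finset.mem_range, Finset.mem_image, Finset.mem_univ, true_and, P]
    constructor
    · rintro ⟨hlt, ⟨j, rfl⟩ | hj⟩
      · exact ⟨j, hlt, rfl⟩
      · exact absurd (hj i) (by omega)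
    · rintro ⟨j, hj, rfl⟩
      exact ⟨hj, Or.inl ⟨j, rfl⟩⟩
  have hlt : ∀ x : Fin n → ℕ, ∀ i, Nat.count (P x) (x i) < n := by
    intro x i
    rw [hcount]
    refine Finset.card_image_le.trans_lt ?_
    refine (Finset.card_lt_card (Finset.filter_ssubset.mpr ⟨i, Finset.mem_univ i, ?_⟩)).trans_eq
      (by simp)
    simp
  have hnth : ∀ x : Fin n → ℕ, ∀ i, Nat.nth (P x) (Nat.count (P x) (x i)) = x i :=
    fun x i => Nat.nth_count (Or.inl ⟨i, rfl⟩)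
  have hxy : ∀ i, Nat.count (P x) (x i) = Nat.count (P y) (y i) := by
    intro i
    have hfilter : (Finset.univ.filter fun j => x j < x i) =
        Finset.univ.filter fun j => y j < y i := by simp only [h.lt_iff]
    rw [hcount, hcount, hfilter]
    refine Finset.card_bij' (fun a _ => y (if ha : ∃ j, x j = a then ha.choose else i))
      (fun a _ => x (if ha : ∃ j, y j = a then ha.choose else i)) ?_ ?_ ?_ ?_
    all_goals
      intro a ha
      obtain ⟨j, hj, rfl⟩ := Finset.mem_image.mp ha
    · have hex : ∃ j', x j' = x j := ⟨j, rfl⟩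
      simp only [dif_pos hex, (h.eq_iff _ _).mp hex.choose_spec]
      exact Finset.mem_image_of_mem _ hj
    · have hex : ∃ j', y j' = y j := ⟨j, rfl⟩
      simp only [dif_pos hex, (h.eq_iff _ _).mpr hex.choose_spec]
      exact Finset.mem_image_of_mem _ hj
    · have hex : ∃ j', x j' = x j := ⟨j, rfl⟩
      have hex' : ∃ j', y j' = y j := ⟨j, rfl⟩
      simp only [dif_pos hex, (h.eq_iff _ _).mp hex.choose_spec, dif_pos hex',
        (h.eq_iff _ _).mpr hex'.choose_spec]
    · have hex : ∃ j', x j' = x j := ⟨j, rfl⟩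
      have hex' : ∃ j', y j' = y j := ⟨j, rfl⟩
      simp only [dif_pos hex', (h.eq_iff _ _).mpr hex'.choose_spec, dif_pos hex,
        (h.eq_iff _ _).mp hex.choose_spec]
  refine ⟨fun i => ⟨Nat.count (P x) (x i), hlt x i⟩, fun j => Nat.nth (P x) j,
    fun j => Nat.nth (P y) j, fun i j hij => Nat.nth_strictMono (hP x) hij,
    fun i j hij => Nat.nth_strictMono (hP y) hij, ?_, ?_⟩
  · funext i; exact (hnth x i).symm
  · funext i; simp only [Function.comp_apply, hxy, hnth]

/-- Ramsey's theorem for a colouring of all `n`-tuples: along a subsequence, the colour depends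
only on the order type of the tuple. -/
theorem exists_strictMono_ordSim {κ : Type*} [Finite κ] (n : ℕ) (c : (Fin n → ℕ) → κ) :
    ∃ φ : ℕ → ℕ, StrictMono φ ∧ ∀ x y : Fin n → ℕ, OrdSim x y → c (φ ∘ x) = c (φ ∘ y) := by
  obtain ⟨φ, hφ, k, hk⟩ := exists_strictMono_homogeneous n
    (fun t => fun ρ : Fin n → Fin n => c (t ∘ ρ))
  refine ⟨φ, hφ, fun x y h => ?_⟩
  obtain ⟨ρ, t, t', ht, ht', rfl, rfl⟩ := exists_rank_factorization x y h
  have := congrFun ((hk t ht).trans (hk t' ht').symm) ρ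
  exact this

/-- Ramsey's theorem for finitely many colourings, of tuples of varying lengths. -/
theorem exists_strictMono_ordSim_family {I : Type*} [Finite I] {κ : I → Type*} [∀ i, Finite (κ i)]
    (n : I → ℕ) (c : ∀ i, (Fin (n i) → ℕ) → κ i) :
    ∃ φ : ℕ → ℕ, StrictMono φ ∧
      ∀ i, ∀ x y : Fin (n i) → ℕ, OrdSim x y → c i (φ ∘ x) = c i (φ ∘ y) := by
  classical
  cases nonempty_fintype I
  suffices H : ∀ s : Finset I, ∃ φ : ℕ → ℕ, StrictMono φ ∧
      ∀ i ∈ s, ∀ x y : Fin (n i) → ℕ, OrdSim x y → c i (φ ∘ x) = c i (φ ∘ y) by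
    simpa using H Finset.univ
  intro s
  induction s using Finset.induction_on with
  | empty => exact ⟨id, strictMono_id, by simp⟩
  | insert i s _ ih =>
    obtain ⟨φ, hφ, h⟩ := ih
    obtain ⟨ψ, hψ, h'⟩ := exists_strictMono_ordSim (n i) (fun x => c i (φ ∘ x))
    refine ⟨φ ∘ ψ, hφ.comp hψ, fun j hj x y hxy => ?_⟩
    obtain rfl | hj := Finset.mem_insert.mp hj
    · exact h' x y hxy
    · exact h j hj (ψ ∘ x) (ψ ∘ y)
        (((OrdSim.of_strictMono hψ x).symm.trans hxy).trans (OrdSim.of_strictMono hψ y))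

/-! ### Monomorphic intervals in terms of tuples -/

section Mono

variable (L : FirstOrder.Language.{u, v}) {M : Type*} [LinearOrder M] [L.Structure M]

/-- No relation distinguishes two order-similar tuples that differ only inside `A`. For an
order-convex set `A` of an ordered structure this says that `A` is a monomorphic interval, see
`isMonomorphicInterval_iff`. -/
def IsMono (A : Set M) : Prop :=
  ∀ ⦃n : ℕ⦄ (r : L.Relations n) (x y : Fin n → M), OrdSim x y →
    (∀ i, x i = y i ∨ (x i ∈ A ∧ y i ∈ A)) → RelMap r x → RelMap r y

/-- Two points are similar if they lie in a common monomorphic interval. The classes of this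
relation form the coarsest interval decomposition. -/
def Sim (x y : M) : Prop :=
  IsMono L (Set.uIcc x y)

variable {L}

theorem IsMono.mono {A B : Set M} (h : IsMono L B) (hAB : A ⊆ B) : IsMono L A :=
  fun _ r x y hxy hA => h r x y hxy fun i => (hA i).imp_right fun ⟨h₁, h₂⟩ => ⟨hAB h₁, hAB h₂⟩

theorem IsMono.iff {A : Set M} (h : IsMono L A) {n : ℕ} (r : L.Relations n) {x y : Fin n → M}
    (hxy : OrdSim x y) (hA : ∀ i, x i = y i ∨ (x i ∈ A ∧ y i ∈ A)) :
    RelMap r x ↔ RelMap r y :=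
  ⟨h r x y hxy hA, h r y x hxy.symm fun i => (hA i).imp Eq.symm And.symm⟩

/-- If entries of `x` can only cross from above `b` to below `b`, then `x` can be moved to `y`
inside `[a, b]` and `[b, c]` in turn: the lowest crossing entry is first brought down to `b`. -/
theorem relMap_iff_of_Icc_of_cross {a b c : M} (hab : a ≤ b) (hbc : b ≤ c)
    (h₁ : IsMono L (Set.Icc a b)) (h₂ : IsMono L (Set.Icc b c)) {n : ℕ} (r : L.Relations n)
    (y : Fin n → M) (N : ℕ) :
    ∀ x : Fin n → M, OrdSim x y → (∀ i, x i = y i ∨ (x i ∈ Set.Icc a c ∧ y i ∈ Set.Icc a c)) →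
      (∀ i, x i ≤ b → y i ≤ b) →
      (Finset.univ.filter fun i => y i ≤ b ∧ b < x i).card ≤ N → (RelMap r x ↔ RelMap r y) := by
  classical
  induction N with
  | zero =>
    intro x hxy hac hb hN
    have hb' : ∀ i, y i ≤ b → x i ≤ b := by
      intro i hi
      by_contra hcon
      have : i ∈ Finset.univ.filter fun i => y i ≤ b ∧ b < x i := by
        simp [hi, not_le.mp hcon]
      exact absurd (Finset.card_pos.mpr ⟨i, this⟩) (by omega)
    let z : Fin n → M := fun i => if x i ≤ b then y i else x i
    have hxz : OrdSim x z := by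
      intro i j
      have := hxy i j
      have hi := hb i
      have hj := hb j
      simp only [z]
      split_ifs with h h' h' <;> grind
    refine (h₁.iff r hxz fun i => ?_).trans (h₂.iff r (hxz.symm.trans hxy) fun i => ?_)
    · have := hac i
      have := hb i
      simp only [z, Set.mem_Icc] at *
      split_ifs <;> grind
    · have := hac i
      have := hb' i
      simp only [z, Set.mem_Icc] at *
      split_ifs <;> grind
  | succ N ih =>
    intro x hxy hac hb hN
    by_cases hne : (Finset.univ.filter fun i => y i ≤ b ∧ b < x i).Nonempty
    swap
    · exact ih x hxy hac hb (by simp [Finset.not_nonempty_iff_eq_empty.mp hne])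
    obtain ⟨k, hk, hmin⟩ := Finset.exists_min_image _ x hne
    simp only [Finset.mem_filter, Finset.mem_univ, true_and] at hk hmin
    obtain ⟨hyk, hxk⟩ := hk
    have hbelow : ∀ i, x i < x k → x i ≤ b := by
      intro i hi
      by_contra hcon
      have := (hxy.lt_iff i k).mp hi
      exact absurd (hmin i ⟨this.le.trans hyk, not_le.mp hcon⟩) (not_le.mpr hi)
    have hyb : ∀ i, x i ≤ b → y i < b := fun i hi =>
      ((hxy.lt_iff i k).mp (hi.trans_lt hxk)).trans_le hyk
    have hkac : x k ∈ Set.Icc a c ∧ y k ∈ Set.Icc a c :=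
      (hac k).resolve_left fun h => absurd hyk (not_le.mpr (h ▸ hxk))
    -- First move the entries below `b` into place within `[a, b]`, which frees `b` itself; then
    -- lower the entries equal to `x k` to `b` within `[b, c]`.
    let w : Fin n → M := fun i => if x i ≤ b then y i else x i
    let z : Fin n → M := fun i => if x i ≤ b then y i else if x i = x k then b else x i
    have hxw : OrdSim x w := by
      intro i j
      have := hxy i j
      have := hyb i
      have := hyb j
      simp only [w]
      split_ifs <;> grind
    have hxz : OrdSim x z := by
      intro i j
      have := hxy i j
      have := hyb i
      have := hyb j
      have := hbelow i
      have := hbelow j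
      simp only [z]
      split_ifs <;> grind
    refine (h₁.iff r hxw fun i => ?_).trans
      ((h₂.iff r (hxw.symm.trans hxz) fun i => ?_).trans
        (ih z (hxz.symm.trans hxy) (fun i => ?_) (fun i => ?_) ?_))
    · have := hac i
      have := hyb i
      simp only [w, Set.mem_Icc] at *
      split_ifs <;> grind
    · simp only [w, z, Set.mem_Icc] at *
      split_ifs <;> grind
    · have := hac i
      simp only [z, Set.mem_Icc] at *
      split_ifs <;> grind
    · have := hyb i
      have := (hxy.eq_iff i k).mp
      have := hb i
      simp only [z]
      split_ifs <;> grind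
    · refine Nat.le_of_lt_succ ((Finset.card_lt_card ?_).trans_le hN)
      refine Finset.ssubset_iff_of_subset (fun i hi => ?_) |>.mpr ⟨k, by simp [hyk, hxk], ?_⟩
      · simp only [Finset.mem_filter, Finset.mem_univ, true_and, z] at hi ⊢
        refine ⟨hi.1, ?_⟩
        by_contra hcon
        rw [if_pos (not_lt.mp hcon)] at hi
        exact absurd hi.2 (not_lt.mpr hi.1)
      · simp [z, hxk.not_ge]

/-- Two monomorphic intervals with a common end point have a monomorphic union. -/
theorem IsMono.Icc_union {a b c : M} (hab : a ≤ b) (hbc : b ≤ c)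
    (h₁ : IsMono L (Set.Icc a b)) (h₂ : IsMono L (Set.Icc b c)) : IsMono L (Set.Icc a c) := by
  intro n r x y hxy hac
  by_cases h : ∀ i, x i ≤ b → y i ≤ b
  · exact (relMap_iff_of_Icc_of_cross hab hbc h₁ h₂ r y _ x hxy hac h le_rfl).mp
  · push Not at h
    obtain ⟨k, hxk, hyk⟩ := h
    refine (relMap_iff_of_Icc_of_cross hab hbc h₁ h₂ r x _ y hxy.symm
      (fun i => (hac i).imp Eq.symm And.symm) (fun i hi => ?_) le_rfl).mpr
    exact ((hxy.lt_iff i k).mpr (hi.trans_lt hyk)).le.trans hxk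

theorem Sim.refl (x : M) : Sim L x x := by
  intro n r y z _ h
  have : y = z := funext fun i => (h i).elim id fun h => by
    simp only [Set.uIcc_self, Set.mem_singleton_iff] at h
    rw [h.1, h.2]
  exact this ▸ id

theorem Sim.symm {x y : M} (h : Sim L x y) : Sim L y x := by
  rwa [Sim, Set.uIcc_comm]

theorem Sim.of_mem {x y z z' : M} (h : Sim L x y) (hz : z ∈ Set.uIcc x y)
    (hz' : z' ∈ Set.uIcc x y) : Sim L z z' :=
  h.mono (Set.uIcc_subset_uIcc hz hz')

theorem Sim.trans {x y z : M} (h : Sim L x y) (h' : Sim L y z) : Sim L x z := by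
  have key : ∀ {a b c : M}, a ≤ b → b ≤ c → Sim L a b → Sim L b c → Sim L a c := by
    intro a b c hab hbc h h'
    rw [Sim, Set.uIcc_of_le (hab.trans hbc)]
    rw [Sim, Set.uIcc_of_le hab] at h
    rw [Sim, Set.uIcc_of_le hbc] at h'
    exact h.Icc_union hab hbc h'
  rcases le_total x y with hxy | hxy <;> rcases le_total y z with hyz | hyz
  · exact key hxy hyz h h'
  · rcases le_total x z with hxz | hxz
    · exact h.of_mem Set.left_mem_uIcc (Set.mem_uIcc.mpr (Or.inl ⟨hxz, hyz⟩))
    · exact h'.of_mem (Set.mem_uIcc.mpr (Or.inr ⟨hxz, hxy⟩)) Set.right_mem_uIcc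
  · rcases le_total x z with hxz | hxz
    · exact h'.of_mem (Set.mem_uIcc.mpr (Or.inl ⟨hxy, hxz⟩)) Set.right_mem_uIcc
    · exact h.of_mem Set.left_mem_uIcc (Set.mem_uIcc.mpr (Or.inr ⟨hyz, hxz⟩))
  · exact (key hyz hxy h'.symm h.symm).symm

variable (L M) in
/-- The partition into the classes of `Sim` is the coarsest interval decomposition. -/
def simSetoid : Setoid M where
  r := Sim L
  iseqv := ⟨Sim.refl, Sim.symm, Sim.trans⟩

/-- Classes of `Sim` are order-convex, so points of distinct classes are compared as the classes
are. -/
theorem Sim.le_iff_le {x x' y y' : M} (hx : Sim L x x') (hy : Sim L y y') (h : ¬ Sim L x y) :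
    x ≤ y ↔ x' ≤ y' := by
  have key : ∀ {x x' y y' : M}, Sim L x x' → Sim L y y' → ¬ Sim L x y → x ≤ y → x' ≤ y' := by
    intro x x' y y' hx hy h hxy
    by_contra! hcon
    rcases le_total x y' with h₁ | h₁
    · exact h ((hx.of_mem Set.left_mem_uIcc
        (Set.mem_uIcc.mpr (Or.inl ⟨h₁, hcon.le⟩))).trans hy.symm)
    · exact h (hy.symm.of_mem (Set.mem_uIcc.mpr (Or.inl ⟨h₁, hxy⟩)) Set.right_mem_uIcc)
  exact ⟨key hx hy h, key hx.symm hy.symm fun h' => h (hx.trans (h'.trans hy.symm))⟩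

/-- Relations do not distinguish order-similar tuples whose corresponding entries are similar:
the entries can be moved one class at a time. -/
theorem relMap_iff_of_sim {n : ℕ} (r : L.Relations n) {x y : Fin n → M} (hxy : OrdSim x y)
    (h : ∀ i, Sim L (x i) (y i)) : RelMap r x ↔ RelMap r y := by
  classical
  -- `z s` replaces the entries of `x` whose class meets a class of an entry with index in `s`.
  let z : Finset (Fin n) → Fin n → M := fun s i =>
    if ∃ j ∈ s, Sim L (x i) (x j) then y i else x i
  have hz : ∀ s, OrdSim x (z s) := by
    intro s i j
    by_cases hij : Sim L (x i) (x j)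
    · have : (∃ k ∈ s, Sim L (x i) (x k)) ↔ ∃ k ∈ s, Sim L (x j) (x k) :=
        exists_congr fun k => and_congr_right fun _ => ⟨hij.symm.trans, hij.trans⟩
      simp only [z, this]
      split_ifs
      · exact hxy i j
      · rfl
    · refine Sim.le_iff_le ?_ ?_ hij <;> simp only [z] <;> split_ifs
      exacts [h i, Sim.refl _, h j, Sim.refl _]
  have main : ∀ s : Finset (Fin n), RelMap r x ↔ RelMap r (z s) := by
    intro s
    induction s using Finset.induction_on with
    | empty => simp [z]
    | insert k s _ ih =>
      refine ih.trans ?_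
      let t : Finset M := (Finset.univ.filter fun i => Sim L (x i) (x k)).image x ∪
        (Finset.univ.filter fun i => Sim L (x i) (x k)).image y
      have ht : ∀ i, Sim L (x i) (x k) → x i ∈ t ∧ y i ∈ t := fun i hi =>
        ⟨Finset.mem_union_left _ (Finset.mem_image_of_mem _ (by simpa using hi)),
          Finset.mem_union_right _ (Finset.mem_image_of_mem _ (by simpa using hi))⟩
      have hne : t.Nonempty := ⟨_, (ht k (Sim.refl _)).1⟩
      have hsim : ∀ a ∈ t, Sim L a (x k) := by
        intro a ha
        simp only [t, Finset.mem_union, Finset.mem_image, Finset.mem_filter, Finset.mem_univ,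
          true_and] at ha
        rcases ha with ⟨i, hi, rfl⟩ | ⟨i, hi, rfl⟩
        exacts [hi, (h i).symm.trans hi]
      have hmono : Sim L (t.min' hne) (t.max' hne) :=
        (hsim _ (t.min'_mem hne)).trans (hsim _ (t.max'_mem hne)).symm
      have hmem : ∀ a ∈ t, a ∈ Set.uIcc (t.min' hne) (t.max' hne) := fun a ha =>
        Set.mem_uIcc.mpr (Or.inl ⟨t.min'_le a ha, t.le_max' a ha⟩)
      refine IsMono.iff hmono r ((hz s).symm.trans (hz _)) fun i => ?_
      by_cases hi : Sim L (x i) (x k)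
      · refine Or.inr ⟨hmem _ ?_, hmem _ ?_⟩ <;> simp only [z] <;> split_ifs
        exacts [(ht i hi).2, (ht i hi).1, (ht i hi).2, (ht i hi).1]
      · left
        simp [z, hi]
  have hy : z Finset.univ = y := funext fun i => if_pos ⟨i, Finset.mem_univ i, Sim.refl _⟩
  exact hy ▸ main Finset.univ

theorem isMono_of_sim {A : Set M} (h : ∀ x ∈ A, ∀ y ∈ A, Sim L x y) : IsMono L A :=
  fun _ r _ _ hxy hA => (relMap_iff_of_sim r hxy fun i =>
    (hA i).elim (fun e => e ▸ Sim.refl _) fun ⟨h₁, h₂⟩ => h _ h₁ _ h₂).mp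

/-- Similarity is inherited by substructures. -/
theorem Sim.of_embedding {N : Type*} [LinearOrder N] [L.Structure N] {f : N → M}
    (hf : StrictMono f) (hr : ∀ (n : ℕ) (r : L.Relations n) (x : Fin n → N),
      RelMap r (f ∘ x) ↔ RelMap r x) {x y : N} (h : Sim L (f x) (f y)) : Sim L x y := by
  intro n r z z' hz hxy hrz
  have hmem : ∀ a ∈ Set.uIcc x y, f a ∈ Set.uIcc (f x) (f y) := fun a ha =>
    hf.monotone.image_uIcc_subset (Set.mem_image_of_mem f ha)
  refine (hr n r z').mp (h r (f ∘ z) (f ∘ z') ?_ (fun i => (hxy i).imp (congrArg f)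
    fun ⟨h₁, h₂⟩ => ⟨hmem _ h₁, hmem _ h₂⟩) ((hr n r z).mpr hrz))
  exact ((OrdSim.of_strictMono hf z).symm.trans hz).trans (OrdSim.of_strictMono hf z')

/-! ### Comparison with the definition by finite restrictions -/

variable [L.IsOrdered] [L.OrderedStructure M]

@[simp] theorem le_iff {a b : M} : Le L a b ↔ a ≤ b := by
  rw [Le, relMap_leSymb]
  rfl

theorem isOrdered_of_orderedStructure : IsOrdered L M := by
  refine { refl := fun a => ?_, trans := fun a b c => ?_, antisymm := fun a b => ?_,
           total := fun a b => ?_ }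
  · exact le_iff.mpr le_rfl
  · simpa using le_trans
  · simpa using le_antisymm
  · simpa using le_total a b

theorem isInterval_iff {A : Set M} : IsInterval L A ↔ A.OrdConnected := by
  simp only [IsInterval, le_iff, Set.ordConnected_iff]
  constructor
  · exact fun h a ha b hb _ c hc => h a ha b hb c hc.1 hc.2
  · exact fun h a ha b hb c hac hcb => h a ha b hb (hac.trans hcb) ⟨hac, hcb⟩

theorem equiv_le_iff {N : Type*} [LinearOrder N] [L.Structure N] [L.OrderedStructure N]
    (e : M ≃[L] N) (a b : M) : e a ≤ e b ↔ a ≤ b := by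
  rw [← le_iff (L := L), ← le_iff (L := L), Le, Le, ← e.map_rel]
  refine iff_of_eq (congrArg _ (funext fun i => ?_))
  fin_cases i <;> rfl

/-- The order isomorphism underlying an isomorphism of ordered structures. -/
def equivToOrderIso {N : Type*} [LinearOrder N] [L.Structure N] [L.OrderedStructure N]
    (e : M ≃[L] N) : M ≃o N where
  toEquiv := e.toEquiv
  map_rel_iff' := equiv_le_iff e _ _

/-- Order-convex sets on which finite tuples can be moved freely are the monomorphic intervals. -/
theorem isMonomorphicInterval_iff [L.IsRelational] {A : Set M} :
    IsMonomorphicInterval L A ↔ A.OrdConnected ∧ IsMono L A := by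
  classical
  rw [IsMonomorphicInterval, isInterval_iff]
  refine and_congr_right fun hA => ⟨fun h n r x y hxy hxA hr => ?_, fun h F F' hcard hF => ?_⟩
  · let F := Finset.univ.image x
    let F' := Finset.univ.image y
    let f : F → F' := fun a => ⟨y (Finset.mem_image.mp a.2).choose,
      Finset.mem_image_of_mem _ (Finset.mem_univ _)⟩
    have hf : ∀ i h, f ⟨x i, h⟩ = ⟨y i, Finset.mem_image_of_mem _ (Finset.mem_univ _)⟩ :=
      fun i h => Subtype.ext ((hxy.eq_iff _ _).mp (Finset.mem_image.mp h).choose_spec.2)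
    have hmono : StrictMono f := by
      rintro ⟨a, ha⟩ ⟨b, hb⟩ hab
      obtain ⟨i, -, rfl⟩ := Finset.mem_image.mp ha
      obtain ⟨j, -, rfl⟩ := Finset.mem_image.mp hb
      rw [hf, hf]
      exact (hxy.lt_iff i j).mp hab
    have hsurj : Function.Surjective f := by
      rintro ⟨b, hb⟩
      obtain ⟨j, -, rfl⟩ := Finset.mem_image.mp hb
      exact ⟨⟨x j, Finset.mem_image_of_mem _ (Finset.mem_univ _)⟩, hf j _⟩
    let e := hmono.orderIsoOfSurjective f hsurj
    have hdiff : (F : Set M) \ A = (F' : Set M) \ A := by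
      ext a
      simp only [F, F', Finset.coe_image, Finset.coe_univ, Set.image_univ, Set.mem_sdiff,
        Set.mem_range]
      refine and_congr_left fun ha => ⟨?_, ?_⟩
      · rintro ⟨i, rfl⟩
        exact ⟨i, ((hxA i).resolve_right fun h => ha h.1).symm⟩
      · rintro ⟨i, rfl⟩
        exact ⟨i, ((hxA i).resolve_right fun h => ha h.2)⟩
    obtain ⟨g⟩ := h F F' (by simpa using Fintype.card_congr e.toEquiv) hdiff
    -- A finite chain has a unique isomorphism onto another one, hence `g` maps `x i` to `y i`.
    have hg : equivToOrderIso g = e :=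
      Subsingleton.elim (α := (F : Set M) ≃o (F' : Set M)) _ _
    have hgx : ∀ i h, (g ⟨x i, h⟩ : M) = y i := fun i h => by
      change ((equivToOrderIso g ⟨x i, h⟩ : (F' : Set M)) : M) = y i
      rw [hg]
      exact congrArg Subtype.val (hf i h)
    have hxF : ∀ i, x i ∈ restr L (F : Set M) := fun i =>
      Finset.mem_coe.mpr (Finset.mem_image_of_mem x (Finset.mem_univ i))
    have h₂ := (g.map_rel r (fun i => ⟨x i, hxF i⟩)).mpr hr
    have : y = (restr L (F' : Set M)).subtype ∘ g ∘ (fun i => ⟨x i, hxF i⟩) :=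
      funext fun i => (hgx i _).symm
    rw [this, Embedding.map_rel]
    exact h₂
  · -- The isomorphism is the identity off `A` and increasing from `F ∩ A` onto `F' ∩ A`.
    have hdiff : ∀ a, a ∉ A → (a ∈ F ↔ a ∈ F') := fun a ha => by
      have := congrArg (a ∈ ·) hF
      simpa [ha] using this
    have hcardA : (F.filter (· ∈ A)).card = (F'.filter (· ∈ A)).card := by
      have h₁ := Finset.card_filter_add_card_filter_not (s := F) (· ∈ A)
      have h₂ := Finset.card_filter_add_card_filter_not (s := F') (· ∈ A)
      have : F.filter (¬ · ∈ A) = F'.filter (¬ · ∈ A) := by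
        ext a
        simp only [Finset.mem_filter]
        exact and_congr_left (hdiff a)
      rw [this] at h₁
      omega
    let e : F.filter (· ∈ A) ≃o F'.filter (· ∈ A) :=
      ((F.filter (· ∈ A)).orderIsoOfFin rfl).symm.trans
        ((F'.filter (· ∈ A)).orderIsoOfFin hcardA.symm)
    let f : F → F' := fun a => if ha : a.1 ∈ A then
        ⟨e ⟨a, Finset.mem_filter.mpr ⟨a.2, ha⟩⟩, (Finset.mem_filter.mp (e _).2).1⟩
      else ⟨a, (hdiff a ha).mp a.2⟩
    have hfA : ∀ a : F, a.1 = (f a).1 ∨ (a.1 ∈ A ∧ (f a).1 ∈ A) := by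
      intro a
      by_cases ha : a.1 ∈ A
      · simp only [f, dif_pos ha]
        exact Or.inr ⟨ha, (Finset.mem_filter.mp (e _).2).2⟩
      · simp only [f, dif_neg ha]
        exact Or.inl trivial
    have hlt : ∀ a ∈ A, ∀ a' ∈ A, ∀ c ∉ A, (a < c → a' < c) ∧ (c < a → c < a') := by
      intro a ha a' ha' c hc
      refine ⟨fun hac => ?_, fun hac => ?_⟩
      · by_contra! hcon
        exact hc (hA.out ha ha' ⟨hac.le, hcon⟩)
      · by_contra! hcon
        exact hc (hA.out ha' ha ⟨hcon, hac.le⟩)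
    have hmono : StrictMono f := by
      rintro ⟨a, ha⟩ ⟨b, hb⟩ hab
      rw [← Subtype.coe_lt_coe] at hab ⊢
      have h₁ := hfA ⟨a, ha⟩
      have h₂ := hfA ⟨b, hb⟩
      by_cases haA : a ∈ A <;> by_cases hbA : b ∈ A
      · simp only [f, dif_pos haA, dif_pos hbA]
        exact e.strictMono hab
      · have hb' : (f ⟨b, hb⟩ : M) = b := by simp only [f, dif_neg hbA]
        rw [hb']
        rcases h₁ with h₁ | h₁
        · rw [← h₁]; exact hab
        · exact (hlt a haA _ h₁.2 b hbA).1 hab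
      · have ha' : (f ⟨a, ha⟩ : M) = a := by simp only [f, dif_neg haA]
        rw [ha']
        rcases h₂ with h₂ | h₂
        · rw [← h₂]; exact hab
        · exact (hlt b hbA _ h₂.2 a haA).2 hab
      · simp only [f, dif_neg haA, dif_neg hbA]
        exact hab
    have hbij : Function.Bijective f :=
      (Fintype.bijective_iff_injective_and_card f).mpr ⟨hmono.injective, by simpa using hcard⟩
    refine ⟨{ toEquiv := Equiv.ofBijective f hbij, map_fun' := fun g => isEmptyElim g,
              map_rel' := fun r x => ?_ }⟩
    refine (h.iff r (x := fun i => (x i : M)) (y := fun i => (f (x i) : M)) ?_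
      fun i => hfA (x i)).symm
    exact OrdSim.of_strictMono hmono x

theorem isIntervalDecomposition_classes [L.IsRelational] :
    IsIntervalDecomposition L (simSetoid L M).classes := by
  refine ⟨Setoid.isPartition_classes _, ?_⟩
  rintro _ ⟨y, rfl⟩
  have hsim : ∀ a ∈ {x | (simSetoid L M) x y}, ∀ b ∈ {x | (simSetoid L M) x y}, Sim L a b :=
    fun a ha b hb => Sim.trans ha (Sim.symm hb)
  refine isMonomorphicInterval_iff.mpr ⟨⟨fun a ha b hb c hc => ?_⟩, isMono_of_sim hsim⟩
  have : Sim L a c := (hsim a ha b hb).of_mem Set.left_mem_uIcc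
    (Set.mem_uIcc.mpr (Or.inl ⟨hc.1, hc.2⟩))
  exact this.symm.trans ha

theorem IsIntervalDecomposition.sim [L.IsRelational] {P : Set (Set M)}
    (hP : IsIntervalDecomposition L P) {A : Set M} (hA : A ∈ P) {x y : M} (hx : x ∈ A)
    (hy : y ∈ A) : Sim L x y :=
  have h := isMonomorphicInterval_iff.mp (hP.2 A hA)
  h.2.mono (h.1.uIcc_subset hx hy)

end Mono

/-! ### Witnesses of dissimilarity -/

/-- The positions of a witness: the lower end point `inl false` and the upper end point `inl true`,
and the two tuples `inr (false, i)` and `inr (true, i)`, of which a relation of arity `n ≤ m` uses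
the first `n` entries. -/
abbrev WitIdx (m : ℕ) : Type := Bool ⊕ (Bool × Fin m)

section Witness

variable (L : FirstOrder.Language.{u, v}) {M N : Type*}

/-- `w` witnesses that its end points `w (inl false) ≤ w (inl true)` are not similar: some relation
of arity at most `m` distinguishes two order-similar tuples listed by `w` that differ only inside
the interval between the end points. -/
def IsWit {m : ℕ} [LinearOrder M] [L.Structure M] (w : WitIdx m → M) : Prop :=
  w (Sum.inl false) ≤ w (Sum.inl true) ∧
  ∃ (n : ℕ) (h : n ≤ m) (r : L.Relations n),
    OrdSim (fun i => w (Sum.inr (false, Fin.castLE h i)))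
      (fun i => w (Sum.inr (true, Fin.castLE h i))) ∧
    (∀ i, w (Sum.inr (false, Fin.castLE h i)) = w (Sum.inr (true, Fin.castLE h i)) ∨
      ∀ c : Bool, w (Sum.inl false) ≤ w (Sum.inr (c, Fin.castLE h i)) ∧
        w (Sum.inr (c, Fin.castLE h i)) ≤ w (Sum.inl true)) ∧
    RelMap r (fun i => w (Sum.inr (false, Fin.castLE h i))) ∧
    ¬ RelMap r (fun i => w (Sum.inr (true, Fin.castLE h i)))

/-- A chain of witnesses whose intervals follow one another, upwards or downwards. -/
def IsWitSeq {m : ℕ} [LinearOrder M] [L.Structure M] {ι : Type*} [LinearOrder ι]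
    (a : ι → WitIdx m → M) : Prop :=
  (∀ i, IsWit L (a i)) ∧
    ((∀ i j, i < j → a i (Sum.inl true) ≤ a j (Sum.inl false)) ∨
      ∀ i j, i < j → a j (Sum.inl true) ≤ a i (Sum.inl false))

variable {L} {m : ℕ} [LinearOrder M] [L.Structure M] [LinearOrder N] [L.Structure N]

theorem IsWit.not_sim {w : WitIdx m → M} (hw : IsWit L w) :
    ¬ Sim L (w (Sum.inl false)) (w (Sum.inl true)) := by
  obtain ⟨hle, n, h, r, hsim, hdiff, hr, hr'⟩ := hw
  intro hs
  refine hr' (hs r _ _ hsim (fun i => ?_) hr)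
  rw [Set.uIcc_of_le hle]
  exact (hdiff i).imp_right fun h => ⟨h false, h true⟩

theorem exists_isWit (hm : ∀ n, L.Relations n → n ≤ m) {x y : M} (hxy : x ≤ y)
    (h : ¬ Sim L x y) :
    ∃ w : WitIdx m → M, w (Sum.inl false) = x ∧ w (Sum.inl true) = y ∧ IsWit L w := by
  rw [Sim, IsMono, Set.uIcc_of_le hxy] at h
  push Not at h
  obtain ⟨n, r, z, z', hz, hdiff, hr, hr'⟩ := h
  have hn := hm n r
  -- Positions beyond the arity are filled with `x`.
  let w : WitIdx m → M := Sum.elim (fun c => cond c y x)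
    fun p => if hp : p.2.1 < n then (cond p.1 (z' ⟨p.2.1, hp⟩) (z ⟨p.2.1, hp⟩)) else x
  have hw : ∀ c (i : Fin n), w (Sum.inr (c, Fin.castLE hn i)) = cond c (z' i) (z i) :=
    fun c i => by simp [w]
  refine ⟨w, rfl, rfl, hxy, n, hn, r, ?_, fun i => ?_, ?_, ?_⟩
  · simp only [hw]
    exact hz
  · simp only [hw]
    refine (hdiff i).imp_right fun h c => ?_
    cases c
    exacts [h.1, h.2]
  · simp only [hw]
    exact hr
  · simp only [hw]
    exact hr'

/-- Being a witness depends only on the quantifier-free type. -/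
theorem IsWit.congr [L.IsOrdered] [L.OrderedStructure M] [L.OrderedStructure N]
    {w : WitIdx m → M} {w' : WitIdx m → N}
    (h : ∀ (n : ℕ) (r : L.Relations n) (t : Fin n → WitIdx m),
      RelMap r (w ∘ t) ↔ RelMap r (w' ∘ t)) (hw : IsWit L w) : IsWit L w' := by
  have hle : ∀ p q, w p ≤ w q ↔ w' p ≤ w' q := by
    intro p q
    have := h 2 leSymb ![p, q]
    rwa [relMap_leSymb, relMap_leSymb] at this
  have heq : ∀ p q, w p = w q ↔ w' p = w' q := by
    intro p q
    simp only [le_antisymm_iff, hle]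
  obtain ⟨h₁, n, hn, r, hsim, hdiff, hr, hr'⟩ := hw
  refine ⟨(hle _ _).mp h₁, n, hn, r, fun i j => ?_, fun i => ?_, ?_, ?_⟩
  · rw [← hle, ← hle]
    exact hsim i j
  · simp only [← hle, ← heq]
    exact hdiff i
  · exact (h n r _).mp hr
  · exact fun hc => hr' ((h n r _).mpr hc)

/-- The interval of the first of two members in the order of the chain, or of the second if the
chain descends, lies between their lower end points. -/
theorem IsWitSeq.not_sim {ι : Type*} [LinearOrder ι] {a : ι → WitIdx m → M} (ha : IsWitSeq L a)
    {i j : ι} (hij : i ≠ j) : ¬ Sim L (a i (Sum.inl false)) (a j (Sum.inl false)) := by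
  have key : ∀ {i j}, i < j → ¬ Sim L (a i (Sum.inl false)) (a j (Sum.inl false)) := by
    intro i j hij hs
    obtain ⟨hw, h | h⟩ := ha
    · exact (hw i).not_sim (hs.of_mem Set.left_mem_uIcc
        (Set.mem_uIcc.mpr (Or.inl ⟨(hw i).1, h i j hij⟩)))
    · exact (hw j).not_sim (hs.of_mem Set.right_mem_uIcc
        (Set.mem_uIcc.mpr (Or.inr ⟨(hw j).1, h i j hij⟩)))
  rcases lt_or_gt_of_ne hij with h | h
  · exact key h
  · exact fun hs => key h hs.symm

theorem IsWitSeq.comp {ι κ : Type*} [LinearOrder ι] [LinearOrder κ] {a : ι → WitIdx m → M}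
    (ha : IsWitSeq L a) {φ : κ → ι} (hφ : StrictMono φ) : IsWitSeq L (a ∘ φ) :=
  ⟨fun i => ha.1 (φ i), ha.2.imp (fun h _ _ hij => h _ _ (hφ hij)) fun h _ _ hij => h _ _ (hφ hij)⟩

theorem exists_not_sim_of_injective {ι : Type*} {f : ι → (simSetoid L M).classes}
    (hf : Function.Injective f) : ∃ x : ι → M, ∀ i j, Sim L (x i) (x j) → i = j := by
  choose x hx using fun i => (f i).2
  refine ⟨x, fun i j hij => hf (Subtype.ext ?_)⟩
  rw [hx i, hx j]
  ext z
  exact ⟨fun h => Sim.trans h hij, fun h => Sim.trans h hij.symm⟩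

section Decomposition

variable [L.IsOrdered] [L.IsRelational] [L.OrderedStructure M]

/-- An interval decomposition has at least as many blocks as a chain of witnesses has members. -/
theorem IsWitSeq.exists_injective {ι : Type*} [LinearOrder ι] {a : ι → WitIdx m → M}
    (ha : IsWitSeq L a) {P : Set (Set M)} (hP : IsIntervalDecomposition L P) :
    ∃ f : ι → P, Function.Injective f := by
  choose f hf using fun i => (hP.1.2 (a i (Sum.inl false))).exists
  refine ⟨fun i => ⟨f i, (hf i).1⟩, fun i j hij => ?_⟩
  by_contra hne
  refine ha.not_sim hne (hP.sim (hf i).1 (hf i).2 ?_)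
  rw [show f i = f j from congrArg Subtype.val hij]
  exact (hf j).2

/-- More than `k` classes yield `k` consecutive witnesses, indexed by an initial segment of `ℕ` so
that chains of different lengths can be compared. -/
theorem exists_wit_of_not_hasIntervalDecompositionLE (hm : ∀ n, L.Relations n → n ≤ m) {k : ℕ}
    (h : ¬ HasIntervalDecompositionLE L M k) :
    ∃ a : ℕ → WitIdx m → M, (∀ i < k, IsWit L (a i)) ∧
      ∀ i j, i < j → j < k → a i (Sum.inl true) ≤ a j (Sum.inl false) := by
  classical
  have hcard : (k : ℕ∞) + 1 ≤ (simSetoid L M).classes.encard := by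
    rw [ENat.add_one_le_iff (ENat.natCast_ne_top k)]
    by_contra! hcon
    exact h ⟨_, isIntervalDecomposition_classes, hcon⟩
  obtain ⟨t, hts, ht⟩ := Set.exists_subset_encard_eq hcard
  have htfin : t.Finite := Set.finite_of_encard_eq_coe (k := k + 1) (by simpa using ht)
  have htn : t.ncard = k + 1 := by rw [Set.ncard, ht]; rfl
  have := htfin.to_subtype
  let e : Fin (k + 1) ≃ t := (Finite.equivFinOfCardEq (by simpa using htn)).symm
  obtain ⟨x, hx⟩ := exists_not_sim_of_injective (L := L) (M := M)
    (f := fun i => ⟨e i, hts (e i).2⟩) fun i j hij => e.injective (Subtype.ext (by simpa using hij))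
  have hxinj : Function.Injective x := fun i j hij => hx i j (hij ▸ Sim.refl _)
  let X : Finset M := Finset.univ.image x
  have hX : X.card = k + 1 := by simp [X, Finset.card_image_of_injective _ hxinj]
  let y : Fin (k + 1) ↪o M := X.orderEmbOfFin hX
  have hy : ∀ i j, Sim L (y i) (y j) → i = j := by
    intro i j hij
    obtain ⟨i', -, hi'⟩ := Finset.mem_image.mp (X.orderEmbOfFin_mem hX i)
    obtain ⟨j', -, hj'⟩ := Finset.mem_image.mp (X.orderEmbOfFin_mem hX j)
    refine y.injective ?_
    change X.orderEmbOfFin hX i = X.orderEmbOfFin hX j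
    change Sim L (X.orderEmbOfFin hX i) (X.orderEmbOfFin hX j) at hij
    rw [← hi', ← hj'] at hij ⊢
    exact congrArg x (hx _ _ hij)
  have hW : ∀ i : ℕ, ∃ w : WitIdx m → M, ∀ hi : i < k,
      w (Sum.inl false) = y ⟨i, by omega⟩ ∧ w (Sum.inl true) = y ⟨i + 1, by omega⟩ ∧
        IsWit L w := by
    intro i
    by_cases hi : i < k
    · obtain ⟨w, hw⟩ := exists_isWit hm (y.monotone (a := ⟨i, by omega⟩) (b := ⟨i + 1, by omega⟩)
        (by simp [Fin.le_def])) fun hs => by simpa using hy _ _ hs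
      exact ⟨w, fun _ => hw⟩
    · exact ⟨fun _ => y 0, fun h => absurd h hi⟩
  choose a ha using hW
  refine ⟨a, fun i hi => (ha i hi).2.2, fun i j hij hj => ?_⟩
  rw [(ha i (hij.trans hj)).2.1, (ha j hj).1]
  exact y.monotone (by simpa [Fin.le_def] using hij)

/-- Representatives of infinitely many classes contain a monotone sequence. -/
theorem exists_isWitSeq_of_not_finite (hm : ∀ n, L.Relations n → n ≤ m)
    (h : ¬ ∃ P : Set (Set M), IsIntervalDecomposition L P ∧ P.Finite) :
    ∃ a : ℕ → WitIdx m → M, IsWitSeq L a := by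
  have hinf : (simSetoid L M).classes.Infinite := fun hfin =>
    h ⟨_, isIntervalDecomposition_classes, hfin⟩
  obtain ⟨x, hx⟩ := exists_not_sim_of_injective (hinf.natEmbedding _).injective
  obtain ⟨g, hg⟩ := exists_increasing_or_nonincreasing_subseq (· < ·) x
  have hns : ∀ i, ¬ Sim L (x (g i)) (x (g (i + 1))) := fun i hs => by
    have := g.injective (hx _ _ hs)
    omega
  rcases hg with hg | hg
  · choose a ha using fun i => exists_isWit hm (hg i (i + 1) (Nat.lt_succ_self i)).le (hns i)
    have hmono : StrictMono fun i => x (g i) := fun i j hij => hg i j hij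
    refine ⟨a, fun i => (ha i).2.2, Or.inl fun i j hij => ?_⟩
    rw [(ha i).2.1, (ha j).1]
    exact hmono.monotone hij
  · have hanti : Antitone fun i => x (g i) := fun i j hij => by
      rcases hij.eq_or_lt with rfl | hlt
      · exact le_rfl
      · exact not_lt.mp (hg i j hlt)
    choose a ha using fun i => exists_isWit hm (hanti (Nat.le_succ i)) fun hs => hns i hs.symm
    refine ⟨a, fun i => (ha i).2.2, Or.inr fun i j hij => ?_⟩
    rw [(ha j).2.1, (ha i).1]
    exact hanti hij

end Decomposition

/-- The linear order of an ordered structure. -/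
@[reducible] noncomputable def IsOrdered.linearOrder {M : Type w} [L.IsOrdered] [L.Structure M]
    (h : IsOrdered L M) : LinearOrder M where
  le := Le L
  le_refl := h.refl
  le_trans := h.trans
  le_antisymm := h.antisymm
  le_total := h.total
  toDecidableLE := Classical.decRel _

theorem IsOrdered.orderedStructure {M : Type w} [L.IsOrdered] [L.Structure M]
    (h : IsOrdered L M) : letI := h.linearOrder; L.OrderedStructure M := by
  let _ := h.linearOrder
  refine ⟨fun x => ?_⟩
  change _ ↔ RelMap leSymb ![x 0, x 1]
  refine iff_of_eq (congrArg _ (funext fun i => ?_))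
  fin_cases i <;> rfl

theorem IsWitSeq.mem_classD {M : Type w} [LinearOrder M] [L.Structure M] [L.IsOrdered]
    [L.IsRelational] [L.OrderedStructure M] {a : ℕ → WitIdx m → M} (ha : IsWitSeq L a) :
    (CategoryTheory.Bundled.of M : CategoryTheory.Bundled.{w} L.Structure) ∈ classD L := by
  have hM : IsOrdered L M := isOrdered_of_orderedStructure
  refine ⟨hM, ?_⟩
  rintro ⟨(P : Set (Set M)), hP, hfin⟩
  obtain ⟨f, hf⟩ := ha.exists_injective hP
  have : Finite P := hfin
  exact not_injective_infinite_finite f hf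

end Witness

/-! ### Almost multichains over the natural numbers -/

section Multichain

variable {L : FirstOrder.Language.{u, v}}

/-- An almost multichain is determined by its relations on tuples using only the first indices of
the chain, as many as the arity. -/
theorem IsAlmostMultichain.relMap_iff {F K : Type} [L.Structure (F ⊕ (ULift.{w} ℕ × K))]
    (h : IsAlmostMultichain L F K (ULift.{w} ℕ)) {n : ℕ} (r : L.Relations n)
    (u : Fin n → F ⊕ (Fin n × K)) {τ : Fin n → ℕ} (hτ : StrictMono τ) :
    RelMap r (fun i => Sum.map id (Prod.map (fun p : Fin n => ULift.up.{w} p.val) id) (u i)) ↔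
      RelMap r (fun i => Sum.map id (Prod.map (fun p : Fin n => ULift.up.{w} (τ p)) id) (u i)) := by
  have hf : StrictMono fun p : Fin n => ULift.up.{w} p.val := fun _ _ h => h
  have hg : StrictMono fun p : Fin n => ULift.up.{w} (τ p) := fun _ _ h => hτ h
  have := h _ _ ((hf.orderIso).symm.trans hg.orderIso) n r
    (fun i => Sum.map id (Prod.map hf.orderIso id) (u i))
  refine (iff_of_eq (congrArg _ (funext fun i => ?_))).trans
    (this.trans (iff_of_eq (congrArg _ (funext fun i => ?_))))
  · rcases u i with f | ⟨p, k⟩ <;> rfl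
  · rcases u i with f | ⟨p, k⟩
    · rfl
    · simp only [Sum.map_inr, Prod.map_apply, OrderIso.trans_apply, OrderIso.symm_apply_apply, id]
      rfl

/-- Over given finite parts there are only finitely many almost multichains along `ℕ`. -/
theorem finite_setOf_isAlmostMultichain (L : FirstOrder.Language.{u, v}) [L.IsRelational]
    [Finite (Σ n, L.Relations n)] (F K : Type) [Finite F] [Finite K] :
    {_S : L.Structure (F ⊕ (ULift.{w} ℕ × K)) |
      IsAlmostMultichain L F K (ULift.{w} ℕ)}.Finite := by
  refine Set.Finite.of_injOn (t := Set.univ)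
    (f := fun (S : L.Structure (F ⊕ (ULift.{w} ℕ × K))) =>
      fun (r : Σ n, L.Relations n) (u : Fin r.1 → F ⊕ (Fin r.1 × K)) =>
        S.RelMap r.2
          (fun i => Sum.map id (Prod.map (fun p : Fin r.1 => ULift.up.{w} p.val) id) (u i)))
    (Set.mapsTo_univ _ _) (fun S hS S' hS' heq => ?_) Set.finite_univ
  refine Structure.ext (funext fun n => funext fun f => isEmptyElim f)
    (funext fun n => funext fun r => funext fun t => propext ?_)
  let idx : Fin n → ℕ := fun i => Sum.elim (fun _ => 0) (fun p => p.1.down) (t i)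
  obtain ⟨ρ, τ, -, hτ, -, hidx, -⟩ := exists_rank_factorization idx idx (OrdSim.rfl' _)
  let u : Fin n → F ⊕ (Fin n × K) := fun i => Sum.map id (fun p => (ρ i, p.2)) (t i)
  have htu : t = fun i => Sum.map id (Prod.map (fun p : Fin n => ULift.up.{w} (τ p)) id) (u i) := by
    funext i
    have hi := congrFun hidx i
    rcases hti : t i with f | ⟨⟨p⟩, k⟩
    · simp [u, hti]
    · simp only [idx, hti, Sum.elim_inr, Function.comp_apply] at hi
      simp [u, hti, hi]
  rw [htu]
  have h₁ := @IsAlmostMultichain.relMap_iff L F K S hS n r u τ ‹_›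
  have h₂ := @IsAlmostMultichain.relMap_iff L F K S' hS' n r u τ ‹_›
  have h₃ := iff_of_eq (congrFun (congrFun heq ⟨n, r⟩) u)
  exact h₁.symm.trans (h₃.trans h₂)

/-- The almost multichains along `ℕ` without finite interval decomposition whose finite parts are
sets of positions of a witness. -/
def templates (L : FirstOrder.Language.{u, v}) [L.IsRelational] [L.IsOrdered] (m : ℕ) :
    Set (CategoryTheory.Bundled.{w} L.Structure) :=
  (⋃ F : Set (WitIdx m), ⋃ K : Set (WitIdx m),
    (fun S => ⟨F ⊕ (ULift.{w} ℕ × K), S⟩) ''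
      {_S : L.Structure (F ⊕ (ULift.{w} ℕ × K)) | IsAlmostMultichain L F K (ULift.{w} ℕ)}) ∩
    classD L

theorem finite_templates (L : FirstOrder.Language.{u, v}) [L.IsRelational] [L.IsOrdered]
    [Finite (Σ n, L.Relations n)] (m : ℕ) : (templates.{u, v, w} L m).Finite :=
  (Set.finite_iUnion fun F => Set.finite_iUnion fun K =>
    (finite_setOf_isAlmostMultichain L F K).image _).inter_of_left _

theorem isAlmostMultichainable_of_mem_templates [L.IsRelational] [L.IsOrdered] {m : ℕ}
    {T : CategoryTheory.Bundled.{w} L.Structure} (hT : T ∈ templates L m) :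
    IsAlmostMultichainable L T := by
  obtain ⟨h, -⟩ := hT
  simp only [Set.mem_iUnion] at h
  obtain ⟨F, K, S, hS, rfl⟩ := h
  exact ⟨F, K, inferInstance, inferInstance, ULift.{w} ℕ, inferInstance, S, hS,
    ⟨Language.Equiv.refl L _⟩⟩

/-- The sequence `b` of tuples is order-indiscernible for quantifier-free formulas. -/
def IsIndiscernible (L : FirstOrder.Language.{u, v}) {M Ω : Type*} [L.Structure M]
    (b : ℕ → Ω → M) : Prop :=
  ∀ (n : ℕ) (r : L.Relations n) (k : Fin n → Ω) (x y : Fin n → ℕ), OrdSim x y →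
    (RelMap r (fun i => b (x i) (k i)) ↔ RelMap r (fun i => b (y i) (k i)))

theorem exists_isIndiscernible {M Ω : Type*} [Finite Ω] [L.Structure M]
    [Finite (Σ n, L.Relations n)] (a : ℕ → Ω → M) :
    ∃ φ : ℕ → ℕ, StrictMono φ ∧ IsIndiscernible L (a ∘ φ) := by
  obtain ⟨φ, hφ, h⟩ := exists_strictMono_ordSim_family
    (I := Σ n, L.Relations n) (κ := fun r => (Fin r.1 → Ω) → Prop) (fun r => r.1)
    (fun r x k => RelMap r.2 (fun i => a (x i) (k i)))
  exact ⟨φ, hφ, fun n r k x y hxy => iff_of_eq (congrFun (h ⟨n, r⟩ x y hxy) k)⟩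

variable [L.IsOrdered] {M : Type*} [LinearOrder M] [L.Structure M] [L.OrderedStructure M]

namespace IsIndiscernible

variable {Ω : Type*} {b : ℕ → Ω → M}

theorem eq_iff (hb : IsIndiscernible L b) {i j i' j' : ℕ} (h₁ : i ≤ j ↔ i' ≤ j')
    (h₂ : j ≤ i ↔ j' ≤ i') (k l : Ω) : b i k = b j l ↔ b i' k = b j' l := by
  have key : ∀ {i j i' j' : ℕ} (k l : Ω), (i ≤ j ↔ i' ≤ j') → (j ≤ i ↔ j' ≤ i') →
      (b i k ≤ b j l ↔ b i' k ≤ b j' l) := by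
    intro i j i' j' k l h₁ h₂
    have := hb 2 leSymb ![k, l] ![i, j] ![i', j'] (by
      intro p q
      fin_cases p <;> fin_cases q <;> simp [h₁, h₂])
    rwa [relMap_leSymb, relMap_leSymb] at this
  rw [le_antisymm_iff, le_antisymm_iff, key k l h₁ h₂, key l k h₂ h₁]

/-- A coincidence between entries at different indices forces both columns to be constant. -/
theorem const_of_eq (hb : IsIndiscernible L b) {i j : ℕ} (hij : i < j) {k l : Ω}
    (h : b i k = b j l) : (∀ p, b p k = b 0 k) ∧ ∀ p, b p l = b 0 l := by
  have hall : ∀ p q, p < q → b p k = b q l := fun p q hpq =>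
    (hb.eq_iff (by omega) (by omega) k l).mp h
  have hl : ∀ p q, p < q → b p l = b q l := fun p q hpq =>
    (hb.eq_iff (i := 1) (j := 2) (by omega) (by omega) l l).mp
      ((hall 0 1 (by omega)).symm.trans (hall 0 2 (by omega)))
  refine ⟨fun p => (hall p (p + 1) (by omega)).trans (hall 0 (p + 1) (by omega)).symm, fun p => ?_⟩
  rcases Nat.eq_zero_or_pos p with rfl | hp
  · rfl
  · exact (hl 0 p hp).symm

end IsIndiscernible

/-- An indiscernible sequence of tuples spans an almost multichain: the constant columns give the
finite part `F` and the other columns, up to repetitions, the fibre `K`. -/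
theorem exists_almostMultichain_of_isIndiscernible [L.IsRelational] {Ω : Type} {b : ℕ → Ω → M}
    (hb : IsIndiscernible L b) :
    ∃ (F K : Set Ω) (g : F ⊕ (ULift.{w} ℕ × K) → M), Function.Injective g ∧
      (∀ i k, ∃ t, g t = b i k) ∧
      ∀ (D D' : Set (ULift.{w} ℕ)) (h : D ≃o D') (n : ℕ) (r : L.Relations n)
        (x : Fin n → F ⊕ (D × K)),
        RelMap r (fun i => g (Sum.map id (Prod.map (fun d : D => (d : ULift ℕ)) id) (x i))) ↔
          RelMap r (fun i =>
            g (Sum.map id (Prod.map (fun d : D => (h d : ULift ℕ)) id) (x i))) := by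
  classical
  have hcol : ∀ {k l : Ω} (i j : ℕ), b i k = b i l → b j k = b j l := fun i j h =>
    (hb.eq_iff (by omega) (by omega) _ _).mp h
  -- `rep` selects one column from each set of equal columns.
  let rep : Ω → Ω := fun k => (⟨k, rfl⟩ : ∃ l, b 0 l = b 0 k).choose
  have hrep : ∀ i k, b i (rep k) = b i k := fun i k =>
    hcol 0 i (⟨k, rfl⟩ : ∃ l, b 0 l = b 0 k).choose_spec
  have hrepinj : ∀ i k l, rep k = k → rep l = l → b i k = b i l → k = l := by
    intro i k l hk hl h
    rw [← hk, ← hl]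
    simp only [rep, hcol i 0 h]
  let F : Set Ω := {k | (∀ p, b p k = b 0 k) ∧ rep k = k}
  let K : Set Ω := {k | ¬ (∀ p, b p k = b 0 k) ∧ rep k = k}
  have hreprep : ∀ k, rep (rep k) = rep k := fun k => by
    change Exists.choose _ = Exists.choose _
    simp only [hrep]
  let g : F ⊕ (ULift.{w} ℕ × K) → M := Sum.elim (fun k => b 0 k) fun p => b p.1.down p.2
  refine ⟨F, K, g, ?_, ?_, ?_⟩
  · rintro (⟨k, hk⟩ | ⟨⟨i⟩, ⟨k, hk⟩⟩) (⟨l, hl⟩ | ⟨⟨j⟩, ⟨l, hl⟩⟩) h <;>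
      simp only [g, Sum.elim_inl, Sum.elim_inr] at h
    · exact congrArg _ (Subtype.ext (hrepinj 0 k l hk.2 hl.2 h))
    · rw [← hk.1 j] at h
      exact absurd (hrepinj j k l hk.2 hl.2 h) fun e => hl.1 (e ▸ hk.1)
    · rw [← hl.1 i] at h
      exact absurd (hrepinj i k l hk.2 hl.2 h) fun e => hk.1 (e ▸ hl.1)
    · rcases lt_trichotomy i j with hij | rfl | hij
      · exact absurd (hb.const_of_eq hij h).1 hk.1
      · rw [Subtype.mk_eq_mk.mpr (hrepinj i k l hk.2 hl.2 h)]
      · exact absurd (hb.const_of_eq hij h.symm).1 hl.1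
  · intro i k
    by_cases hk : ∀ p, b p (rep k) = b 0 (rep k)
    · exact ⟨Sum.inl ⟨rep k, hk, hreprep k⟩, (hk i).symm.trans (hrep i k)⟩
    · exact ⟨Sum.inr (⟨i⟩, ⟨rep k, hk, hreprep k⟩), hrep i k⟩
  · intro D D' h n r x
    -- Constant columns may be read at any index; an index beyond all others keeps the two index
    -- tuples order-similar.
    let J : ℕ := 1 + ∑ i, Sum.elim (fun _ => 0)
      (fun p => (p.1 : ULift ℕ).down + (h p.1 : ULift ℕ).down) (x i)
    have hJ : ∀ i (d : D) (k : K), x i = Sum.inr (d, k) →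
        (d : ULift ℕ).down < J ∧ (h d : ULift ℕ).down < J := by
      intro i d k hi
      have := Finset.single_le_sum (f := fun i => Sum.elim (fun _ => 0)
        (fun p => (p.1 : ULift ℕ).down + (h p.1 : ULift ℕ).down) (x i))
        (fun _ _ => Nat.zero_le _) (Finset.mem_univ i)
      simp only [hi, Sum.elim_inr] at this
      omega
    let X : Fin n → ℕ := fun i => Sum.elim (fun _ => J) (fun p => (p.1 : ULift ℕ).down) (x i)
    let Y : Fin n → ℕ := fun i => Sum.elim (fun _ => J) (fun p => (h p.1 : ULift ℕ).down) (x i)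
    let c : Fin n → Ω := fun i => Sum.elim (fun k : F => (k : Ω)) (fun p : D × K => (p.2 : Ω)) (x i)
    have hXY : OrdSim X Y := by
      intro i j
      rcases hi : x i with k | ⟨d, k⟩ <;> rcases hj : x j with l | ⟨e, l⟩ <;>
        simp only [X, Y, hi, hj, Sum.elim_inl, Sum.elim_inr]
      · have := hJ j e l hj
        omega
      · have := hJ i d k hi
        omega
      · exact (h.le_iff_le (x := d) (y := e)).symm
    have hX : (fun i => g (Sum.map id (Prod.map (fun d : D => (d : ULift ℕ)) id) (x i))) =
        fun i => b (X i) (c i) := by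
      funext i
      rcases hi : x i with k | ⟨d, k⟩
      · simp only [g, X, c, hi, Sum.map_inl, Sum.elim_inl, id]
        exact (k.2.1 J).symm
      · simp [g, X, c, hi]
    have hY : (fun i => g (Sum.map id (Prod.map (fun d : D => (h d : ULift ℕ)) id) (x i))) =
        fun i => b (Y i) (c i) := by
      funext i
      rcases hi : x i with k | ⟨d, k⟩
      · simp only [g, Y, c, hi, Sum.map_inl, Sum.elim_inl, id]
        exact (k.2.1 J).symm
      · simp [g, Y, c, hi]
    rw [hX, hY]
    exact hb n r c X Y hXY

/-- A substructure containing all entries of an infinite chain of witnesses has no finite interval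
decomposition. -/
theorem IsWitSeq.mem_classD_of_injective [L.IsRelational] {m : ℕ} {a : ℕ → WitIdx m → M}
    (ha : IsWitSeq L a) {T : Type w} [L.Structure T] {g : T → M} (hg : Function.Injective g)
    (hr : ∀ (n : ℕ) (r : L.Relations n) (t : Fin n → T), RelMap r t ↔ RelMap r (g ∘ t))
    (hcover : ∀ i k, ∃ t, g t = a i k) :
    (CategoryTheory.Bundled.of T : CategoryTheory.Bundled.{w} L.Structure) ∈ classD L := by
  let _ : LinearOrder T := LinearOrder.lift' g hg
  have hO : L.OrderedStructure T := ⟨fun t => (hr 2 leSymb t).trans (relMap_leSymb (g ∘ t))⟩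
  choose pre hpre using hcover
  have hseq : IsWitSeq L pre := by
    obtain ⟨hw, hs⟩ := ha
    refine ⟨fun i => (hw i).congr fun n r t => ?_, ?_⟩
    · rw [hr, show g ∘ pre i ∘ t = a i ∘ t from funext fun j => hpre i (t j)]
    · change (∀ i j, i < j → g (pre i _) ≤ g (pre j _)) ∨ ∀ i j, i < j → g (pre j _) ≤ g (pre i _)
      simpa only [hpre] using hs
  exact hseq.mem_classD

/-- An infinite chain of witnesses contains, by Ramsey's theorem, one of the templates. -/
theorem IsWitSeq.exists_template [L.IsRelational] [Finite (Σ n, L.Relations n)] {m : ℕ}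
    {a : ℕ → WitIdx m → M} (ha : IsWitSeq L a) :
    ∃ T ∈ templates.{u, v, w} L m, Nonempty (T ↪[L] M) := by
  obtain ⟨φ, hφ, hb⟩ := exists_isIndiscernible (L := L) a
  obtain ⟨F, K, g, hg, hcover, hmulti⟩ := exists_almostMultichain_of_isIndiscernible.{u, v, w} hb
  let S : L.Structure (F ⊕ (ULift.{w} ℕ × K)) :=
    { funMap := fun f => isEmptyElim f, RelMap := fun r t => RelMap r (g ∘ t) }
  refine ⟨⟨_, S⟩, ⟨?_, (ha.comp hφ).mem_classD_of_injective hg (fun _ _ _ => Iff.rfl) hcover⟩,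
    ⟨⟨⟨g, hg⟩, fun f => isEmptyElim f, fun _ _ => Iff.rfl⟩⟩⟩
  simp only [Set.mem_iUnion]
  exact ⟨F, K, S, fun D D' h n r x => hmulti D D' h n r x, rfl⟩

end Multichain

/-! ### Ages of structures without finite interval decomposition -/

/-- Below a finite set of a preorder there is a finite antichain of its elements. -/
theorem exists_finite_antichain {α : Type*} {r : α → α → Prop} (hrefl : ∀ a, r a a)
    (htrans : ∀ a b c, r a b → r b c → r a c) {s : Set α} (hs : s.Finite) :
    ∃ t ⊆ s, (∀ a ∈ t, ∀ b ∈ t, a ≠ b → ¬ r a b) ∧ ∀ b ∈ s, ∃ a ∈ t, r a b := by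
  induction s, hs using Set.Finite.induction_on with
  | empty => exact ⟨∅, subset_rfl, by simp, by simp⟩
  | @insert c s _ _ ih =>
    obtain ⟨t, hts, hanti, hbelow⟩ := ih
    by_cases hc : ∃ a ∈ t, r a c
    · refine ⟨t, hts.trans (Set.subset_insert _ _), hanti, fun b hb => ?_⟩
      rcases hb with rfl | hb
      exacts [hc, hbelow b hb]
    · push Not at hc
      refine ⟨insert c {a ∈ t | ¬ r c a}, Set.insert_subset_insert fun a ha => hts ha.1, ?_, ?_⟩
      · rintro a (rfl | ha) b (rfl | hb) hab
        exacts [absurd rfl hab, hb.2, hc a ha.1, hanti a ha.1 b hb.1 hab]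
      · rintro b (rfl | hb)
        · exact ⟨b, Set.mem_insert _ _, hrefl b⟩
        · obtain ⟨a, ha, hab⟩ := hbelow b hb
          by_cases hca : r c a
          · exact ⟨c, Set.mem_insert _ _, htrans _ _ _ hca hab⟩
          · exact ⟨a, Set.mem_insert_of_mem _ ⟨ha, hca⟩, hab⟩

variable {L : FirstOrder.Language.{u, v}}

section Ultraproduct

open Filter

variable {S : ℕ → Type w} [∀ i, L.Structure (S i)] (U : Ultrafilter ℕ)

/-- Łoś's theorem for atomic formulas. -/
theorem relMap_ultraproduct_iff {n : ℕ} (r : L.Relations n) (z : Fin n → ∀ i, S i) :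
    RelMap r (fun j => (z j : (U : Filter ℕ).Product S)) ↔ ∀ᶠ i in U, RelMap r fun j => z j i :=
  relMap_quotient_mk' _ _ _

/-- The relations on finitely many elements of an ultraproduct are those in almost all factors. -/
theorem eventually_relMap_iff [Finite (Σ n, L.Relations n)] {ι : Type*} [Finite ι]
    (z : ι → ∀ i, S i) :
    ∀ᶠ i in U, ∀ (n : ℕ) (r : L.Relations n) (t : Fin n → ι),
      RelMap r (fun j => (z (t j) : (U : Filter ℕ).Product S)) ↔ RelMap r fun j => z (t j) i := by
  have : ∀ᶠ i in U, ∀ (r : Σ n, L.Relations n) (t : Fin r.1 → ι),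
      RelMap r.2 (fun j => (z (t j) : (U : Filter ℕ).Product S)) ↔
        RelMap r.2 fun j => z (t j) i := by
    refine eventually_all.mpr fun r => eventually_all.mpr fun t => ?_
    by_cases h : RelMap r.2 (fun j => (z (t j) : (U : Filter ℕ).Product S))
    · filter_upwards [(relMap_ultraproduct_iff U _ _).mp h] with i hi
      simp only [h, hi]
    · filter_upwards [Ultrafilter.eventually_not.mpr
        fun hc => h ((relMap_ultraproduct_iff U _ _).mpr hc)] with i hi
      simp only [h, hi]
  filter_upwards [this] with i hi n r t using hi ⟨n, r⟩ t

variable [L.IsOrdered]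

theorem le_ultraproduct_iff [∀ i, LinearOrder (S i)] [∀ i, L.OrderedStructure (S i)]
    (x y : ∀ i, S i) :
    Le L (x : (U : Filter ℕ).Product S) (y : (U : Filter ℕ).Product S) ↔
      ∀ᶠ i in U, x i ≤ y i := by
  have := relMap_ultraproduct_iff U (leSymb : L.Relations 2) ![x, y]
  simp only [relMap_leSymb] at this
  rw [Le]
  refine (iff_of_eq (congrArg _ (funext fun i => ?_))).trans this
  fin_cases i <;> rfl

theorem isOrdered_ultraproduct [∀ i, LinearOrder (S i)] [∀ i, L.OrderedStructure (S i)] :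
    IsOrdered L ((U : Filter ℕ).Product S) where
  refl := by
    rintro ⟨x⟩
    exact (le_ultraproduct_iff U x x).mpr (Eventually.of_forall fun _ => le_rfl)
  trans := by
    rintro ⟨x⟩ ⟨y⟩ ⟨z⟩ h₁ h₂
    refine (le_ultraproduct_iff U x z).mpr ?_
    filter_upwards [(le_ultraproduct_iff U x y).mp h₁, (le_ultraproduct_iff U y z).mp h₂] with i
    exact le_trans
  antisymm := by
    rintro ⟨x⟩ ⟨y⟩ h₁ h₂
    refine Quotient.sound ?_
    change ∀ᶠ i in U, x i = y i
    filter_upwards [(le_ultraproduct_iff U x y).mp h₁, (le_ultraproduct_iff U y x).mp h₂] with i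
    exact le_antisymm
  total := by
    rintro ⟨x⟩ ⟨y⟩
    refine ((Ultrafilter.eventually_or (f := U)).mp
      (Eventually.of_forall fun i => le_total (x i) (y i))).imp ?_ ?_
    exacts [(le_ultraproduct_iff U x y).mpr, (le_ultraproduct_iff U y x).mpr]

/-- Every finite substructure of an ultraproduct embeds in one of the factors. -/
theorem exists_embedding_of_mem_age_ultraproduct [L.IsRelational] [Finite (Σ n, L.Relations n)]
    [∀ i, LinearOrder (S i)] [∀ i, L.OrderedStructure (S i)]
    {N : CategoryTheory.Bundled.{w} L.Structure} (hN : N ∈ L.age ((U : Filter ℕ).Product S)) :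
    ∃ i, Nonempty (N ↪[L] S i) := by
  obtain ⟨hfg, ⟨f⟩⟩ := hN
  have : Finite N := hfg.finite
  choose z hz using fun a => Quotient.exists_rep (f a)
  obtain ⟨i, hi⟩ := (eventually_relMap_iff (L := L) U z).exists
  have hrel : ∀ (n : ℕ) (r : L.Relations n) (t : Fin n → N),
      RelMap r (fun j => z (t j) i) ↔ RelMap r t := fun n r t => by
    rw [← hi, ← f.map_rel r t]
    refine iff_of_eq (congrArg _ (funext fun j => hz (t j)))
  refine ⟨i, ⟨⟨⟨fun a => z a i, fun a b hab => ?_⟩, fun g => isEmptyElim g, hrel _⟩⟩⟩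
  -- Equality is the conjunction of two inequalities, hence is reflected as well.
  have hle : ∀ p q : N, z p i ≤ z q i → Le L (f p) (f q) := fun p q hpq => by
    have h₁ := (hi 2 (leSymb : L.Relations 2) ![p, q]).mpr ((relMap_leSymb _).mpr hpq)
    rw [Le]
    refine (iff_of_eq (congrArg _ (funext fun j => ?_))).mp h₁
    fin_cases j
    exacts [hz p, hz q]
  have hab : z a i = z b i := hab
  exact f.injective ((isOrdered_ultraproduct (L := L) (S := S) U).antisymm _ _
    (hle a b hab.le) (hle b a hab.ge))

end Ultraproduct

variable [L.IsRelational] [L.IsOrdered]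

theorem exists_isWitSeq_of_mem_classD {m : ℕ} (hm : ∀ n, L.Relations n → n ≤ m)
    {R : CategoryTheory.Bundled.{w} L.Structure} (hR : R ∈ classD L) :
    letI := IsOrdered.linearOrder hR.1; ∃ a : ℕ → WitIdx m → R, IsWitSeq L a := by
  let _ := IsOrdered.linearOrder hR.1
  have := IsOrdered.orderedStructure hR.1
  exact exists_isWitSeq_of_not_finite hm hR.2

/-- Finitely many witnesses already live in a finite substructure. -/
theorem exists_mem_age_not_hasIntervalDecompositionLE {m : ℕ} (hm : ∀ n, L.Relations n → n ≤ m)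
    {R : CategoryTheory.Bundled.{w} L.Structure} (hR : R ∈ classD L) (k : ℕ) :
    ∃ B ∈ L.age R, ¬ HasIntervalDecompositionLE L B k := by
  let _ := IsOrdered.linearOrder hR.1
  have := IsOrdered.orderedStructure hR.1
  obtain ⟨a, ha⟩ := exists_isWitSeq_of_mem_classD hm hR
  let G : Set R := ⋃ i : Fin (k + 1), Set.range (a i)
  have hG : G.Finite := Set.finite_iUnion fun i => Set.finite_range _
  have : Finite (restr L G) := hG
  refine ⟨⟨restr L G, inferInstance⟩, ⟨FG.of_finite, ⟨(restr L G).subtype⟩⟩, ?_⟩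
  rintro ⟨(P : Set (Set (restr L G))), hP, hk⟩
  let a' : Fin (k + 1) → WitIdx m → restr L G := fun i p =>
    ⟨a i p, Set.mem_iUnion.mpr ⟨i, p, rfl⟩⟩
  have ha' : IsWitSeq L a' := by
    obtain ⟨hw, hs⟩ := ha.comp (φ := fun i : Fin (k + 1) => i.val) fun _ _ h => h
    exact ⟨fun i => (hw i).congr fun n r t => ((restr L G).subtype.map_rel r (a' i ∘ t)), hs⟩
  obtain ⟨f, hf⟩ := ha'.exists_injective hP
  have hPfin : P.Finite := Set.finite_of_encard_le_coe hk
  have : Finite P := hPfin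
  have h₁ := Nat.card_le_card_of_injective f hf
  rw [Nat.card_eq_fintype_card, Fintype.card_fin, Nat.card_coe_set_eq] at h₁
  have h₂ : (P.ncard : ℕ∞) ≤ k := by rwa [hPfin.cast_ncard_eq]
  have h₃ : P.ncard ≤ k := by exact_mod_cast h₂
  omega

/-- A class of finite ordered structures without a bound on the size of interval decompositions:
an ultraproduct of members with longer and longer chains of witnesses has an infinite chain of
witnesses, and its age lies in the class. -/
theorem exists_template_age_subset [Finite (Σ n, L.Relations n)] {m : ℕ}
    (hm : ∀ n, L.Relations n → n ≤ m) {C : Set (CategoryTheory.Bundled.{w} L.Structure)}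
    (hC : ∀ S ∈ C, Finite S ∧ IsOrdered L S) (hher : Hereditary C)
    (h : ∀ k : ℕ, ∃ S ∈ C, ¬ HasIntervalDecompositionLE L S k) :
    ∃ T ∈ templates.{u, v, w} L m, L.age T ⊆ C := by
  choose S hSC hS using h
  let _ : ∀ i, LinearOrder (S i) := fun i => IsOrdered.linearOrder (hC _ (hSC i)).2
  have : ∀ i, L.OrderedStructure (S i) := fun i => IsOrdered.orderedStructure (hC _ (hSC i)).2
  choose a ha ha' using fun i => exists_wit_of_not_hasIntervalDecompositionLE hm (hS i)
  let U : Ultrafilter ℕ := Filter.hyperfilter ℕ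
  have hlarge : ∀ j, ∀ᶠ i in (U : Filter ℕ), j < i := fun j =>
    Nat.hyperfilter_le_atTop (Filter.eventually_gt_atTop j)
  let R := (U : Filter ℕ).Product fun i => S i
  have hR : IsOrdered L R := isOrdered_ultraproduct U
  let _ := hR.linearOrder
  have := hR.orderedStructure
  let b : ℕ → WitIdx m → R := fun j p => ((fun i => a i j p : ∀ i, S i) : R)
  have hb : IsWitSeq L b := by
    refine ⟨fun j => ?_, Or.inl fun j j' hj => ?_⟩
    · obtain ⟨i, hi, hij⟩ := ((eventually_relMap_iff (L := L) U
        fun p i => a i j p).and (hlarge j)).exists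
      exact (ha i j hij).congr fun n r t => (hi n r t).symm
    · refine (le_ultraproduct_iff (L := L) U _ _).mpr ?_
      filter_upwards [hlarge j'] with i hi using ha' i j j' hj hi
  obtain ⟨T, hT, ⟨f⟩⟩ := hb.exists_template
  refine ⟨T, hT, fun N hN => ?_⟩
  have hN' : N ∈ L.age R := ⟨hN.1, hN.2.map f.comp⟩
  obtain ⟨i, hi⟩ := exists_embedding_of_mem_age_ultraproduct U hN'
  exact hher _ (hSC i) ⟨hN.1, hi⟩

/-! ### Counting tuples of natural numbers by their sum -/

section Counting

open Finset.Nat Polynomial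

/-- Sets of tuples closed under decreasing entries, as long as no entry falls below `M` and the
entries below `M` are kept. -/
def IsTruncLower (M : ℕ) {k : ℕ} (X : Set (Fin k → ℕ)) : Prop :=
  ∀ s ∈ X, ∀ s' : Fin k → ℕ, (∀ j, s' j ≤ s j) → (∀ j, min (s' j) M = min (s j) M) → s' ∈ X

open Classical in
/-- The number of members of `X` with sum `n`. -/
noncomputable def sumCount {k : ℕ} (X : Set (Fin k → ℕ)) (n : ℕ) : ℕ :=
  ((antidiagonalTuple k n).filter (· ∈ X)).card

theorem sumCount_succ {k : ℕ} (X : Set (Fin (k + 1) → ℕ)) (n : ℕ) :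
    sumCount X n = ∑ p ∈ Finset.HasAntidiagonal.antidiagonal n,
      sumCount {t | (Fin.cons p.1 t : Fin (k + 1) → ℕ) ∈ X} p.2 := by
  classical
  simp only [sumCount, Finset.card_filter]
  rw [Finset.sum_sigma']
  refine Finset.sum_bij' (fun s _ => ⟨(s 0, ∑ j, s (Fin.succ j)), Fin.tail s⟩)
    (fun x _ => Fin.cons x.1.1 x.2) ?_ ?_ ?_ ?_ ?_
  · intro s hs
    simp_all [mem_antidiagonalTuple, Fin.sum_univ_succ, Fin.tail]
  · intro s hs
    simp_all [mem_antidiagonalTuple, Fin.sum_univ_succ]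
  · simp
  · rintro ⟨⟨i, j⟩, t⟩ hs
    simp_all [mem_antidiagonalTuple]
  · simp

/-- Dickson's lemma, refined by truncation at `M`: lower sets for the refined order satisfy the
descending chain condition. -/
theorem exists_stabilization {k M : ℕ} (X : ℕ → Set (Fin k → ℕ))
    (hX : ∀ i, IsTruncLower M (X i)) (hanti : ∀ i j, M ≤ i → i ≤ j → X j ⊆ X i) :
    ∃ i₀, ∀ i, i₀ ≤ i → X i = X i₀ := by
  by_contra! hcon
  have hstep : ∀ i : {i // M ≤ i}, ∃ i' : {i // M ≤ i}, i.1 ≤ i'.1 ∧ ∃ t ∈ X i, t ∉ X i' := by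
    intro i
    obtain ⟨i', hi', hne⟩ := hcon i
    have hss := (hanti i i' i.2 hi').ssubset_of_ne hne
    exact ⟨⟨i', i.2.trans hi'⟩, hi', Set.exists_of_ssubset hss⟩
  choose nxt hle t ht ht' using hstep
  let idx : ℕ → {i // M ≤ i} := fun n => nxt^[n] ⟨M, le_rfl⟩
  have hidx : ∀ n, idx (n + 1) = nxt (idx n) := fun n => Function.iterate_succ_apply' _ _ _
  have hmono : Monotone fun n => (idx n).1 := monotone_nat_of_le_succ fun n => by
    rw [hidx]
    exact hle _
  -- Comparing also `M - min s M` turns the truncations of comparable tuples into equal ones.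
  let f : ℕ → Fin k ⊕ Fin k → ℕ := fun n =>
    Sum.elim (t (idx n)) fun j => M - min (t (idx n) j) M
  obtain ⟨n, n', hn, hf⟩ := wellQuasiOrdered_le f
  refine ht' (idx n) (hX _ (t (idx n')) ?_ _ (fun j => hf (Sum.inl j)) fun j => ?_)
  · rw [← hidx]
    exact hanti _ _ (idx _).2 (hmono hn) (ht _)
  · have h₁ := hf (Sum.inl j)
    have h₂ := hf (Sum.inr j)
    simp only [f, Sum.elim_inl, Sum.elim_inr] at h₁ h₂
    omega

/-- If the slices eventually agree and have generating functions `p / (1 - x) ^ k`, then the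
generating function of the whole is of the form `p / (1 - x) ^ (k + 1)`. -/
theorem exists_polynomial_of_slices {k : ℕ} (i₀ : ℕ) :
    ∀ c : ℕ → ℕ → ℚ, (∀ i, i₀ ≤ i → c i = c i₀) →
      (∀ i, ∃ p : ℚ[X], PowerSeries.mk (c i) = p * PowerSeries.invOneSubPow ℚ k) →
      ∃ p : ℚ[X], PowerSeries.mk
        (fun n => ∑ q ∈ Finset.HasAntidiagonal.antidiagonal n, c q.1 q.2) =
          p * PowerSeries.invOneSubPow ℚ (k + 1) := by
  induction i₀ with
  | zero =>
    intro c hc hp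
    obtain ⟨p, hp⟩ := hp 0
    refine ⟨p, ?_⟩
    rw [PowerSeries.invOneSubPow_add, Units.val_mul, ← mul_assoc, ← hp,
      PowerSeries.invOneSubPow_val_one_eq_invUnitSub_one]
    ext n
    rw [mul_comm, PowerSeries.coeff_mul]
    simp only [PowerSeries.coeff_mk, PowerSeries.coeff_invUnitsSub]
    exact Finset.sum_congr rfl fun q _ => by rw [hc q.1 (Nat.zero_le _)]; simp
  | succ i₀ ih =>
    intro c hc hp
    obtain ⟨p, hp'⟩ := ih (fun i => c (i + 1))
      (fun i hi => hc (i + 1) (by omega)) fun i => hp (i + 1)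
    obtain ⟨p₀, hp₀⟩ := hp 0
    refine ⟨p₀ * (1 - X) + X * p, ?_⟩
    have hsplit : PowerSeries.mk
        (fun n => ∑ q ∈ Finset.HasAntidiagonal.antidiagonal n, c q.1 q.2) =
        PowerSeries.mk (c 0) + PowerSeries.X * PowerSeries.mk
          (fun n => ∑ q ∈ Finset.HasAntidiagonal.antidiagonal n, c (q.1 + 1) q.2) := by
      ext n
      cases n with
      | zero => simp
      | succ n =>
        rw [map_add, PowerSeries.coeff_succ_X_mul]
        simp [Finset.Nat.antidiagonal_succ]
    rw [hsplit, hp', hp₀]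
    have := PowerSeries.one_sub_pow_mul_invOneSubPow_val_add_eq_invOneSubPow_val ℚ k 1
    rw [← this]
    push_cast
    ring

theorem exists_generatingFunction (M : ℕ) {k : ℕ} (X : Set (Fin k → ℕ)) (hX : IsTruncLower M X) :
    ∃ p : ℚ[X], PowerSeries.mk (fun n => (sumCount X n : ℚ)) =
      p * PowerSeries.invOneSubPow ℚ k := by
  classical
  induction k with
  | zero =>
    refine ⟨C (sumCount X 0 : ℚ), ?_⟩
    ext n
    rw [PowerSeries.invOneSubPow_zero, Units.val_one, mul_one, Polynomial.coe_C,
      PowerSeries.coeff_C, PowerSeries.coeff_mk]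
    cases n with
    | zero => simp
    | succ n => simp [sumCount]
  | succ k ih =>
    let Y : ℕ → Set (Fin k → ℕ) := fun i => {t | (Fin.cons i t : Fin (k + 1) → ℕ) ∈ X}
    have hY : ∀ i, IsTruncLower M (Y i) := fun i t ht t' hle hmin =>
      hX _ ht _ (Fin.cases le_rfl hle) (Fin.cases rfl hmin)
    have hanti : ∀ i j, M ≤ i → i ≤ j → Y j ⊆ Y i := fun i j hi hij t ht =>
      hX _ ht _ (Fin.cases hij fun _ => le_rfl)
        (Fin.cases (by simp [hi, hi.trans hij]) fun _ => rfl)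
    obtain ⟨i₀, hi₀⟩ := exists_stabilization Y hY hanti
    obtain ⟨p, hp⟩ := exists_polynomial_of_slices i₀ (fun i n => (sumCount (Y i) n : ℚ))
      (fun i hi => by rw [hi₀ i hi]) fun i => ih (Y i) (hY i)
    refine ⟨p, ?_⟩
    rw [← hp]
    congr 1
    funext n
    rw [sumCount_succ]
    push_cast
    rfl

theorem natDegree_hilbertPoly_succ_le (p : ℚ[X]) (l : ℕ) :
    (hilbertPoly p (l + 1)).natDegree ≤ l := by
  by_cases h : hilbertPoly p (l + 1) = 0
  · simp [h]
  · rw [natDegree_hilbertPoly_of_ne_zero h]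
    omega

/-- The members of a truncation-lower set of `(l + 1)`-tuples are eventually counted by a polynomial
of degree at most `l`. -/
theorem exists_polynomial_sumCount (M : ℕ) {l : ℕ} (X : Set (Fin (l + 1) → ℕ))
    (hX : IsTruncLower M X) :
    ∃ P : ℚ[X], P.natDegree ≤ l ∧
      ∀ᶠ n : ℕ in Filter.atTop, (sumCount X n : ℚ) = P.eval (n : ℚ) := by
  obtain ⟨p, hp⟩ := exists_generatingFunction M X hX
  refine ⟨hilbertPoly p (l + 1), natDegree_hilbertPoly_succ_le p l, ?_⟩
  filter_upwards [Filter.eventually_gt_atTop p.natDegree] with n hn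
  rw [← coeff_mul_invOneSubPow_eq_hilbertPoly_eval (l + 1) hn, ← hp, PowerSeries.coeff_mk]

end Counting

/-! ### Chains cut into blocks -/

section Blocks

/-- The chain made of consecutive blocks of sizes `s 0, s 1, …`: the pair `(j, p)` is the `p`-th
element of the `j`-th block. -/
abbrev Blocks {k : ℕ} (s : Fin k → ℕ) : Type :=
  {x : Fin k ×ₗ ℕ // (ofLex x).2 < s (ofLex x).1}

namespace Blocks

variable {k : ℕ} {s s' : Fin k → ℕ}

/-- The block of an element. -/
def blk (x : Blocks s) : Fin k := (ofLex x.1).1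

/-- The position of an element in its block. -/
def pos (x : Blocks s) : ℕ := (ofLex x.1).2

/-- The element at a given position of a given block. -/
def mk' (j : Fin k) (p : ℕ) (h : p < s j) : Blocks s := ⟨toLex (j, p), h⟩

@[simp] theorem blk_mk' (j : Fin k) (p : ℕ) (h : p < s j) : (mk' j p h).blk = j := rfl

theorem pos_lt (x : Blocks s) : x.pos < s x.blk := x.2

theorem ext' {x y : Blocks s} (h : x.blk = y.blk) (h' : x.pos = y.pos) : x = y :=
  Subtype.ext (ofLex.injective (Prod.ext h h'))

theorem le_iff {x y : Blocks s} : x ≤ y ↔ x.blk < y.blk ∨ x.blk = y.blk ∧ x.pos ≤ y.pos :=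
  Prod.Lex.le_iff

theorem lt_iff {x y : Blocks s} : x < y ↔ x.blk < y.blk ∨ x.blk = y.blk ∧ x.pos < y.pos :=
  Prod.Lex.lt_iff

theorem blk_mono {x y : Blocks s} (h : x ≤ y) : x.blk ≤ y.blk := by
  rcases le_iff.mp h with h | h
  exacts [h.le, h.1.le]

variable (s) in
/-- The chain of blocks as a disjoint union. -/
def equivSigma : Blocks s ≃ Σ j, Fin (s j) where
  toFun x := ⟨x.blk, x.pos, x.pos_lt⟩
  invFun x := mk' x.1 x.2 x.2.2
  left_inv _ := rfl
  right_inv _ := rfl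

instance : Finite (Blocks s) := Finite.of_equiv _ (equivSigma s).symm

theorem card_eq : Nat.card (Blocks s) = ∑ j, s j := by
  rw [Nat.card_congr (equivSigma s)]
  simp

theorem card_fiber (j : Fin k) : Nat.card {x : Blocks s // x.blk = j} = s j := by
  have e : {x : Blocks s // x.blk = j} ≃ Fin (s j) :=
    { toFun := fun x => ⟨x.1.pos, x.1.pos_lt.trans_eq (congrArg s x.2)⟩
      invFun := fun p => ⟨mk' j p p.2, rfl⟩
      left_inv := fun x => Subtype.ext (ext' x.2.symm rfl)
      right_inv := fun p => rfl }
  rw [Nat.card_congr e]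
  simp

/-- The inclusion of a chain with smaller blocks. -/
def incl (h : ∀ j, s' j ≤ s j) (x : Blocks s') : Blocks s :=
  mk' x.blk x.pos (x.pos_lt.trans_le (h _))

theorem incl_strictMono (h : ∀ j, s' j ≤ s j) : StrictMono (incl h) := fun _ _ hxy => hxy

/-- The number of elements of `V` that precede `x` in its block. -/
def rank (V : Finset (Blocks s)) (x : Blocks s) : ℕ :=
  (V.filter fun y => y.blk = x.blk ∧ y < x).card

theorem rank_lt_card {V : Finset (Blocks s)} {x : Blocks s} (hx : x ∈ V) : rank V x < V.card :=
  Finset.card_lt_card (Finset.filter_ssubset.mpr ⟨x, hx, by simp⟩)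

theorem rank_le_pos (V : Finset (Blocks s)) (x : Blocks s) : rank V x ≤ x.pos := by
  rw [rank, ← Finset.card_range x.pos]
  refine Finset.card_le_card_of_injOn pos (fun y hy => ?_) fun y hy z hz h => ?_
  · simp only [Finset.coe_filter, Set.mem_ofPred_eq, lt_iff] at hy
    simp only [Finset.coe_range, Set.mem_Iio]
    rcases hy.2.2 with h | h
    · exact absurd hy.2.1 h.ne
    · exact h.2
  · simp only [Finset.coe_filter, Set.mem_ofPred_eq] at hy hz
    exact ext' (hy.2.1.trans hz.2.1.symm) h

theorem rank_lt_rank {V : Finset (Blocks s)} {x y : Blocks s} (hx : x ∈ V) (hb : x.blk = y.blk)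
    (h : x < y) : rank V x < rank V y := by
  refine Finset.card_lt_card (Finset.ssubset_iff_of_subset (fun z hz => ?_) |>.mpr ⟨x, ?_, by simp⟩)
  · simp only [Finset.mem_filter] at hz ⊢
    exact ⟨hz.1, hz.2.1.trans hb, hz.2.2.trans h⟩
  · simp [hx, hb, h]

/-- Pushing the elements of `V` to the beginning of their blocks preserves the order. -/
theorem ordSim_of_rank {ι : Type*} {V : Finset (Blocks s)} {x : ι → Blocks s} (hx : ∀ i, x i ∈ V)
    {y : ι → Blocks s'} (hblk : ∀ i, (y i).blk = (x i).blk)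
    (hpos : ∀ i, (y i).pos = rank V (x i)) : OrdSim x y := by
  have key : ∀ i j, x i < x j → y i < y j := by
    intro i j h
    rw [lt_iff, hblk, hblk, hpos, hpos]
    rcases (blk_mono h.le).lt_or_eq with hb | hb
    · exact Or.inl hb
    · exact Or.inr ⟨hb, rank_lt_rank (hx i) hb h⟩
  intro i j
  rcases lt_trichotomy (x i) (x j) with h | h | h
  · exact iff_of_true h.le (key i j h).le
  · have : y i = y j := ext' (by rw [hblk, hblk, h]) (by rw [hpos, hpos, h])
    exact iff_of_true h.le this.le
  · exact iff_of_false h.not_ge (key j i h).not_ge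

end Blocks

end Blocks

/-! ### Structures on chains of blocks -/

section Presentation

open Blocks

variable {L : FirstOrder.Language.{u, v}} {k : ℕ} {s s' : Fin k → ℕ}

/-- The relations of a structure on a chain of blocks among the first `M` positions of each block,
recorded on a domain independent of the sizes of the blocks. -/
def trunc (M : ℕ) (ρ : L.Structure (Blocks s)) :
    ∀ r : Σ n, L.Relations n, (Fin r.1 → Fin k × Fin M) → Prop :=
  fun r t => ∃ h : ∀ i, ((t i).2 : ℕ) < s (t i).1,
    ρ.RelMap r.2 fun i => mk' (t i).1 (t i).2 (h i)

/-- The first positions determine all relations when elements of a block are similar. -/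
theorem relMap_iff_trunc {m M : ℕ} (hm : ∀ n, L.Relations n → n ≤ m) (hM : m ≤ M)
    [ρ : L.Structure (Blocks s)] (hsim : ∀ x y : Blocks s, Sim L x y ↔ x.blk = y.blk) {n : ℕ}
    (r : L.Relations n) (x : Fin n → Blocks s) :
    RelMap r x ↔ trunc M ρ ⟨n, r⟩ fun i => ((x i).blk,
      ⟨rank (Finset.univ.image x) (x i), (rank_lt_card (Finset.mem_image_of_mem x
        (Finset.mem_univ i))).trans_le (Finset.card_image_le.trans
          (by simpa using (hm n r).trans hM))⟩) := by
  let y : Fin n → Blocks s := fun i => mk' (x i).blk (rank (Finset.univ.image x) (x i))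
    ((rank_le_pos _ _).trans_lt (x i).pos_lt)
  have hxy : OrdSim x y := ordSim_of_rank (V := Finset.univ.image x)
    (fun i => Finset.mem_image_of_mem x (Finset.mem_univ i)) (fun _ => rfl) fun _ => rfl
  rw [relMap_iff_of_sim r hxy fun i => (hsim _ _).mpr rfl]
  exact ⟨fun h => ⟨fun i => (y i).pos_lt, h⟩, fun ⟨_, h⟩ => h⟩

/-- For given block sizes, a presentation is determined by its truncation. -/
theorem eq_of_trunc_eq [L.IsRelational] {m M : ℕ} (hm : ∀ n, L.Relations n → n ≤ m) (hM : m ≤ M)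
    {ρ ρ' : L.Structure (Blocks s)} (hsim : letI := ρ; ∀ x y : Blocks s, Sim L x y ↔ x.blk = y.blk)
    (hsim' : letI := ρ'; ∀ x y : Blocks s, Sim L x y ↔ x.blk = y.blk)
    (h : trunc M ρ = trunc M ρ') : ρ = ρ' := by
  refine Structure.ext (funext fun n => funext fun f => isEmptyElim f)
    (funext fun n => funext fun r => funext fun x => propext ?_)
  have h₁ := @relMap_iff_trunc L k s m M hm hM ρ hsim n r x
  have h₂ := @relMap_iff_trunc L k s m M hm hM ρ' hsim' n r x
  rw [h] at h₁
  exact h₁.trans h₂.symm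

/-- Shortening blocks without cutting below `M` keeps the blocks distinct classes, if `M` is large
enough for the blocks to accommodate the two tuples of a witness. -/
theorem sim_iff_of_incl {m M : ℕ} (hm : ∀ n, L.Relations n → n ≤ m) (hM : 2 * m ≤ M)
    [L.Structure (Blocks s)] [L.Structure (Blocks s')] (hle : ∀ j, s' j ≤ s j)
    (hmin : ∀ j, min (s' j) M = min (s j) M)
    (hr : ∀ (n : ℕ) (r : L.Relations n) (x : Fin n → Blocks s'),
      RelMap r (incl hle ∘ x) ↔ RelMap r x)
    (hsim : ∀ x y : Blocks s, Sim L x y ↔ x.blk = y.blk) (x y : Blocks s') :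
    Sim L x y ↔ x.blk = y.blk := by
  have hback : ∀ x y : Blocks s', x.blk = y.blk → Sim L x y := fun x y hxy =>
    Sim.of_embedding (incl_strictMono hle) hr ((hsim _ _).mpr hxy)
  refine ⟨fun h => ?_, hback x y⟩
  suffices key : ∀ x y : Blocks s', Sim L x y → ¬ x.blk < y.blk by
    rcases lt_trichotomy x.blk y.blk with hlt | heq | hlt
    exacts [absurd hlt (key x y h), heq, absurd hlt (key y x h.symm)]
  clear h x y
  intro x y h hlt
  -- All elements of the blocks from that of `x` to that of `y` are similar to `x`.
  have hin : ∀ a : Blocks s', x.blk ≤ a.blk → a.blk ≤ y.blk → Sim L a x := by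
    intro a hxa hay
    rcases hxa.eq_or_lt with hxa | hxa
    · exact hback a x hxa.symm
    · rcases hay.eq_or_lt with hay | hay
      · exact (hback a y hay).trans h.symm
      · exact h.of_mem (Set.mem_uIcc.mpr (Or.inl ⟨(Blocks.lt_iff.mpr (Or.inl hxa)).le,
          (Blocks.lt_iff.mpr (Or.inl hay)).le⟩)) Set.left_mem_uIcc
  have hxy : incl hle x ≤ incl hle y := (Blocks.lt_iff.mpr (Or.inl hlt)).le
  have hns : ¬ Sim L (incl hle x) (incl hle y) := fun hs => hlt.ne ((hsim _ _).mp hs)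
  rw [Sim, IsMono, Set.uIcc_of_le hxy] at hns
  push Not at hns
  obtain ⟨n, r, z, z', hz, hdiff, hrz, hrz'⟩ := hns
  let V : Finset (Blocks s) := Finset.univ.image z ∪ Finset.univ.image z'
  have hV : V.card ≤ M := by
    refine (Finset.card_union_le _ _).trans (le_trans ?_ hM)
    have h₁ : (Finset.univ.image z).card ≤ n := Finset.card_image_le.trans (by simp)
    have h₂ : (Finset.univ.image z').card ≤ n := Finset.card_image_le.trans (by simp)
    have := hm n r
    omega
  have hrank : ∀ a ∈ V, rank V a < s' a.blk := by
    intro a ha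
    have h₁ := (rank_le_pos V a).trans_lt a.pos_lt
    have h₂ := (rank_lt_card ha).trans_le hV
    have h₃ := hmin a.blk
    omega
  have hzV : ∀ i, z i ∈ V := fun i =>
    Finset.mem_union_left _ (Finset.mem_image_of_mem z (Finset.mem_univ i))
  have hzV' : ∀ i, z' i ∈ V := fun i =>
    Finset.mem_union_right _ (Finset.mem_image_of_mem z' (Finset.mem_univ i))
  let φ : ∀ a ∈ V, Blocks s' := fun a ha => mk' a.blk (rank V a) (hrank a ha)
  let c : Fin n → Blocks s' := fun i => φ (z i) (hzV i)
  let c' : Fin n → Blocks s' := fun i => φ (z' i) (hzV' i)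
  have hc : OrdSim z c := ordSim_of_rank hzV (fun _ => rfl) fun _ => rfl
  have hc' : OrdSim z' c' := ordSim_of_rank hzV' (fun _ => rfl) fun _ => rfl
  have h₁ : RelMap r c := (hr n r c).mp ((relMap_iff_of_sim r
    (hc.trans (OrdSim.of_strictMono (incl_strictMono hle) c)) fun i => (hsim _ _).mpr rfl).mp hrz)
  have h₂ : ¬ RelMap r c' := fun hcon => hrz' ((relMap_iff_of_sim r
    (hc'.trans (OrdSim.of_strictMono (incl_strictMono hle) c')) fun i => (hsim _ _).mpr rfl).mpr
      ((hr n r c').mpr hcon))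
  refine h₂ ((relMap_iff_of_sim r ((hc.symm.trans hz).trans hc') fun i => ?_).mp h₁)
  rcases hdiff i with hi | ⟨hi, hi'⟩
  · have : c i = c' i := by simp only [c, c', hi]
    exact this ▸ Sim.refl _
  · have h₃ := blk_mono (s := s) hi.1
    have h₄ := blk_mono (s := s) hi.2
    have h₃' := blk_mono (s := s) hi'.1
    have h₄' := blk_mono (s := s) hi'.2
    exact (hin (c i) h₃ h₄).trans (hin (c' i) h₃' h₄').symm

theorem sim_equiv_iff [L.IsOrdered] {M N : Type*} [LinearOrder M] [LinearOrder N] [L.Structure M]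
    [L.Structure N] [L.OrderedStructure M] [L.OrderedStructure N] (e : M ≃[L] N) (x y : M) :
    Sim L (e x) (e y) ↔ Sim L x y := by
  have key : ∀ {M N : Type _} [LinearOrder M] [LinearOrder N] [L.Structure M]
      [L.Structure N] [L.OrderedStructure M] [L.OrderedStructure N] (e : M ≃[L] N) (x y : M),
      Sim L (e x) (e y) → Sim L x y := fun e x y =>
    Sim.of_embedding (equivToOrderIso e).strictMono fun n r t => e.map_rel r t
  refine ⟨key e x y, fun h => ?_⟩
  refine Sim.of_embedding (equivToOrderIso e.symm).strictMono (fun n r t => e.symm.map_rel r t) ?_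
  change Sim L (e.symm (e x)) (e.symm (e y))
  simpa using h

end Presentation

/-! ### Presentations by block sizes and the profile -/

section Rigidity

open Blocks

variable {k : ℕ} {s s' : Fin k → ℕ}

/-- If the blocks before the `j`-th are preserved by `e` and its inverse, then so is the `j`-th: its
elements cannot move down, and if they moved up, the preimage of the first element of the `j`-th
block of the target, nonempty in this case, could be neither in an earlier block nor in the `j`-th
one. -/
theorem blk_orderIso_of_lt (e : Blocks s ≃o Blocks s')
    (he : ∀ x y, (e x).blk = (e y).blk ↔ x.blk = y.blk)
    (hs' : ∀ i j, i ≤ j → s' i = 0 → s' j = 0) (j : Fin k)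
    (h₁ : ∀ x, x.blk < j → (e x).blk = x.blk) (h₂ : ∀ x, x.blk < j → (e.symm x).blk = x.blk)
    (x : Blocks s) (hx : x.blk = j) : (e x).blk = j := by
  rcases lt_trichotomy (e x).blk j with h | h | h
  · have := h₂ (e x) h
    rw [e.symm_apply_apply, hx] at this
    exact this.symm
  · exact h
  · have hpos : 0 < s' j := Nat.pos_of_ne_zero fun h0 => by
      have := (e x).pos_lt
      rw [hs' _ _ h.le h0] at this
      omega
    have hlt : e.symm (mk' j 0 hpos) < x := by
      rw [← e.lt_iff_lt, e.apply_symm_apply]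
      exact Blocks.lt_iff.mpr (Or.inl h)
    rcases ((blk_mono hlt.le).trans_eq hx).lt_or_eq with hb | hb
    · have := h₁ _ hb
      rw [e.apply_symm_apply, blk_mk'] at this
      exact absurd this hb.ne'
    · have := (he _ x).mpr (hb.trans hx.symm)
      rw [e.apply_symm_apply, blk_mk'] at this
      exact this.symm

/-- An isomorphism of chains of blocks that respects the blocks is the identity. -/
theorem eq_and_val_orderIso (e : Blocks s ≃o Blocks s')
    (he : ∀ x y, (e x).blk = (e y).blk ↔ x.blk = y.blk)
    (hs : ∀ i j, i ≤ j → s i = 0 → s j = 0) (hs' : ∀ i j, i ≤ j → s' i = 0 → s' j = 0) :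
    s = s' ∧ ∀ x, (e x).val = x.val := by
  have he' : ∀ x y, (e.symm x).blk = (e.symm y).blk ↔ x.blk = y.blk := fun x y => by
    rw [← he, e.apply_symm_apply, e.apply_symm_apply]
  have hblk : ∀ j, (∀ x, x.blk = j → (e x).blk = j) ∧ ∀ x, x.blk = j → (e.symm x).blk = j := by
    intro j
    induction j using WellFoundedLT.induction with
    | ind j ih =>
      have h₁ : ∀ x, x.blk < j → (e x).blk = x.blk := fun x hx => (ih _ hx).1 x rfl
      have h₂ : ∀ x, x.blk < j → (e.symm x).blk = x.blk := fun x hx => (ih _ hx).2 x rfl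
      exact ⟨blk_orderIso_of_lt e he hs' j h₁ h₂, blk_orderIso_of_lt e.symm he' hs j h₂ h₁⟩
  have hblk' : ∀ x, (e x).blk = x.blk := fun x => (hblk _).1 x rfl
  have hss : s = s' := funext fun j => by
    rw [← card_fiber (s := s) j, ← card_fiber (s := s') j]
    exact Nat.card_congr (e.toEquiv.subtypeEquiv fun x => by
      change _ ↔ (e x).blk = j
      rw [hblk'])
  subst hss
  refine ⟨rfl, fun x => ?_⟩
  rw [Subsingleton.elim e (OrderIso.refl _)]
  rfl

/-- A monotone map from a finite chain onto an initial segment of `Fin k` cuts the chain into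
blocks. -/
theorem exists_orderIso_blocks {M : Type*} [LinearOrder M] [Finite M] {b : M → Fin k}
    (hb : Monotone b) (hinit : ∀ i j, i ≤ j → j ∈ Set.range b → i ∈ Set.range b) :
    ∃ (s : Fin k → ℕ) (Φ : M ≃o Blocks s), (∀ x, (Φ x).blk = b x) ∧
      ∀ i j, i ≤ j → s i = 0 → s j = 0 := by
  classical
  cases nonempty_fintype M
  let s : Fin k → ℕ := fun j => (Finset.univ.filter fun y => b y = j).card
  let p : M → ℕ := fun x => (Finset.univ.filter fun y => b y = b x ∧ y < x).card
  have hp : ∀ x, p x < s (b x) := fun x => by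
    refine Finset.card_lt_card (Finset.ssubset_iff_of_subset (fun y hy => ?_) |>.mpr ⟨x, ?_, ?_⟩)
    · simp only [Finset.mem_filter] at hy ⊢
      exact ⟨hy.1, hy.2.1⟩
    · simp
    · simp
  let f : M → Blocks s := fun x => mk' (b x) (p x) (hp x)
  have hf : StrictMono f := by
    intro x y hxy
    rw [Blocks.lt_iff]
    rcases (hb hxy.le).lt_or_eq with h | h
    · exact Or.inl h
    · refine Or.inr ⟨h, Finset.card_lt_card
        (Finset.ssubset_iff_of_subset (fun z hz => ?_) |>.mpr ⟨x, ?_, ?_⟩)⟩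
      · simp only [Finset.mem_filter] at hz ⊢
        exact ⟨hz.1, hz.2.1.trans h, hz.2.2.trans hxy⟩
      · simp [h, hxy]
      · simp
  have hcard : Nat.card M = Nat.card (Blocks s) := by
    rw [Blocks.card_eq, Nat.card_eq_fintype_card]
    exact Finset.card_eq_sum_card_fiberwise fun x _ => Finset.mem_univ (b x)
  have hbij : Function.Bijective f := by
    have := Fintype.ofFinite (Blocks s)
    rw [Fintype.bijective_iff_injective_and_card]
    exact ⟨hf.injective, by simpa only [Nat.card_eq_fintype_card] using hcard⟩
  refine ⟨s, hf.orderIsoOfSurjective f hbij.2, fun x => rfl, fun i j hij hi => ?_⟩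
  by_contra hj
  obtain ⟨x, hx⟩ := Finset.card_pos.mp (Nat.pos_of_ne_zero hj)
  obtain ⟨y, hy⟩ := hinit i j hij ⟨x, (Finset.mem_filter.mp hx).2⟩
  exact absurd hi (Finset.card_pos.mpr ⟨y, by simp [hy]⟩).ne'

end Rigidity

section Presentation

open Blocks

variable {L : FirstOrder.Language.{u, v}} [L.IsOrdered] {k : ℕ} {s s' : Fin k → ℕ}

/-- A structure on a chain of blocks that is isomorphic to a member of `C`, compatible with the
order of the chain, and whose similarity classes are the nonempty blocks; these come before the empty
blocks. -/
structure IsPresentation (C : Set (CategoryTheory.Bundled.{w} L.Structure)) (s : Fin k → ℕ)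
    (ρ : L.Structure (Blocks s)) : Prop where
  ordered : L.OrderedStructure (Blocks s)
  exists_mem : ∃ N ∈ C, Nonempty (N ≃[L] Blocks s)
  sim_iff : ∀ x y : Blocks s, Sim L x y ↔ x.blk = y.blk
  eq_zero : ∀ i j, i ≤ j → s i = 0 → s j = 0

variable {C : Set (CategoryTheory.Bundled.{w} L.Structure)}

/-- Isomorphic presentations coincide. -/
theorem IsPresentation.unique {M : ℕ} {ρ : L.Structure (Blocks s)} {ρ' : L.Structure (Blocks s')}
    (h : IsPresentation C s ρ) (h' : IsPresentation C s' ρ')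
    (e : Blocks s ≃[L] Blocks s') : s = s' ∧ trunc M ρ = trunc M ρ' := by
  have := h.ordered
  have := h'.ordered
  obtain ⟨hs, hval⟩ := eq_and_val_orderIso (equivToOrderIso e)
    (fun x y => by rw [← h.sim_iff, ← h'.sim_iff]; exact sim_equiv_iff e x y) h.eq_zero h'.eq_zero
  have hrel : ∀ (n : ℕ) (r : L.Relations n) (x : Fin n → Blocks s) (y : Fin n → Blocks s'),
      (∀ i, (x i).val = (y i).val) → (ρ.RelMap r x ↔ ρ'.RelMap r y) := fun n r x y hxy => by
    rw [show y = e ∘ x from funext fun i => Subtype.ext ((hxy i).symm.trans (hval (x i)).symm)]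
    exact (e.map_rel r x).symm
  subst hs
  exact ⟨rfl, funext fun r => funext fun t => propext (exists_congr fun ht =>
    hrel _ _ _ _ fun _ => rfl)⟩

variable [L.IsRelational]

/-- A finite ordered structure with at most `k` similarity classes lives on a chain of blocks whose
blocks are the classes, numbered from `0`. -/
theorem exists_blocks_of_hasIntervalDecompositionLE {M : Type*} [LinearOrder M] [Finite M]
    [L.Structure M] [L.OrderedStructure M] (h : HasIntervalDecompositionLE L M k) :
    ∃ (s : Fin k → ℕ) (Φ : M ≃o Blocks s), (∀ x y, Sim L x y ↔ (Φ x).blk = (Φ y).blk) ∧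
      ∀ i j, i ≤ j → s i = 0 → s j = 0 := by
  classical
  cases nonempty_fintype M
  obtain ⟨P, hP, hk⟩ := h
  -- Each class is represented by its least element.
  have hne : ∀ x : M, (Finset.univ.filter (Sim L x)).Nonempty := fun x =>
    ⟨x, by simpa using Sim.refl x⟩
  let rep : M → M := fun x => (Finset.univ.filter (Sim L x)).min' (hne x)
  have hrep : ∀ x, Sim L x (rep x) := fun x => by
    simpa using (Finset.univ.filter (Sim L x)).min'_mem (hne x)
  have hrep_le : ∀ x y, Sim L x y → rep x ≤ y := fun x y hxy =>
    Finset.min'_le _ _ (by simpa using hxy)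
  have hrep_iff : ∀ x y, rep x = rep y ↔ Sim L x y := by
    refine fun x y => ⟨fun h => (hrep x).trans (h ▸ (hrep y).symm), fun h => le_antisymm ?_ ?_⟩
    · exact hrep_le _ _ (h.trans (hrep y))
    · exact hrep_le _ _ (h.symm.trans (hrep x))
  have hrep_mono : Monotone rep := by
    intro x y hxy
    by_cases h : Sim L x y
    · exact ((hrep_iff x y).mpr h).le
    · exact ((hrep x).le_iff_le (hrep y) h).mp hxy
  let R : Finset M := Finset.univ.image rep
  have hR : ∀ x, rep x ∈ R := fun x => Finset.mem_image_of_mem rep (Finset.mem_univ x)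
  have hRk : R.card ≤ k := by
    choose B hB using fun x => (hP.1.2 x).exists
    have hPfin : P.Finite := Set.finite_of_encard_le_coe hk
    have h₁ : R.card ≤ P.ncard := by
      rw [← Set.ncard_coe_finset]
      refine Set.ncard_le_ncard_of_injOn B (fun x _ => (hB x).1) (fun x hx y hy hxy => ?_) hPfin
      obtain ⟨x', -, rfl⟩ := Finset.mem_image.mp (Finset.mem_coe.mp hx)
      obtain ⟨y', -, rfl⟩ := Finset.mem_image.mp (Finset.mem_coe.mp hy)
      have hs : Sim L (rep x') (rep y') := hP.sim (hB _).1 (hB _).2 (hxy ▸ (hB _).2)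
      exact (hrep_iff x' y').mpr ((hrep x').trans (hs.trans (hrep y').symm))
    have h₂ : (P.ncard : ℕ∞) ≤ k := by rwa [hPfin.cast_ncard_eq]
    exact h₁.trans (by exact_mod_cast h₂)
  let e : R ≃o Fin R.card := (R.orderIsoOfFin rfl).symm
  let b : M → Fin k := fun x => Fin.castLE hRk (e ⟨rep x, hR x⟩)
  have hb : Monotone b := fun x y hxy => by
    rw [Fin.le_def]
    exact e.monotone (show (⟨rep x, hR x⟩ : R) ≤ ⟨rep y, hR y⟩ from hrep_mono hxy)
  have hbiff : ∀ x y, b x = b y ↔ Sim L x y := fun x y => by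
    rw [← hrep_iff, (Fin.castLE_injective hRk).eq_iff, e.injective.eq_iff, Subtype.mk.injEq]
  have hinit : ∀ i j, i ≤ j → j ∈ Set.range b → i ∈ Set.range b := by
    rintro i j hij ⟨x, rfl⟩
    have hi : i.val < R.card := (Fin.le_def.mp hij).trans_lt (e ⟨rep x, hR x⟩).2
    obtain ⟨y, -, hy⟩ := Finset.mem_image.mp (e.symm ⟨i, hi⟩).2
    refine ⟨y, Fin.ext ?_⟩
    have : (⟨rep y, hR y⟩ : R) = e.symm ⟨i, hi⟩ := Subtype.ext hy
    simp [b, this]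
  obtain ⟨s, Φ, hΦ, hs⟩ := exists_orderIso_blocks hb hinit
  exact ⟨s, Φ, fun x y => by rw [hΦ, hΦ, hbiff], hs⟩

theorem exists_isPresentation (hC : ∀ S ∈ C, Finite S ∧ IsOrdered L S)
    {N : CategoryTheory.Bundled.{w} L.Structure} (hN : N ∈ C)
    (h : HasIntervalDecompositionLE L N k) :
    ∃ (s : Fin k → ℕ) (ρ : L.Structure (Blocks s)), IsPresentation C s ρ ∧
      Nonempty (N ≃[L] Blocks s) := by
  have := (hC N hN).1
  let _ := IsOrdered.linearOrder (hC N hN).2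
  have := IsOrdered.orderedStructure (hC N hN).2
  obtain ⟨s, Φ, hΦ, hs⟩ := exists_blocks_of_hasIntervalDecompositionLE h
  let ρ : L.Structure (Blocks s) := Φ.toEquiv.inducedStructure
  let e : N ≃[L] Blocks s := Φ.toEquiv.inducedStructureEquiv
  have hO : L.OrderedStructure (Blocks s) := ⟨fun x => by
    refine (relMap_leSymb (L := L) (Φ.symm ∘ x)).trans ?_
    exact Φ.symm.le_iff_le⟩
  refine ⟨s, ρ, ⟨hO, ⟨N, hN, ⟨e⟩⟩, fun x y => ?_, hs⟩, ⟨e⟩⟩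
  obtain ⟨x, rfl⟩ := e.surjective x
  obtain ⟨y, rfl⟩ := e.surjective y
  rw [sim_equiv_iff]
  exact hΦ x y

/-- A class closed under finite substructures keeps its presentations when blocks are shortened
without cutting below `M`. -/
theorem IsPresentation.exists_of_le {m M : ℕ} (hm : ∀ n, L.Relations n → n ≤ m) (hM : 2 * m < M)
    (hher : Hereditary C) {ρ : L.Structure (Blocks s)} (h : IsPresentation C s ρ)
    (hle : ∀ j, s' j ≤ s j) (hmin : ∀ j, min (s' j) M = min (s j) M) :
    ∃ ρ' : L.Structure (Blocks s'), IsPresentation C s' ρ' ∧ trunc M ρ' = trunc M ρ := by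
  let ρ' : L.Structure (Blocks s') :=
    { funMap := fun f => isEmptyElim f, RelMap := fun r x => RelMap r (incl hle ∘ x) }
  have := h.ordered
  obtain ⟨N, hN, ⟨e⟩⟩ := h.exists_mem
  let j : Blocks s' ↪[L] Blocks s :=
    ⟨⟨incl hle, (incl_strictMono hle).injective⟩, fun f => isEmptyElim f, fun _ _ => Iff.rfl⟩
  let f : Blocks s' ↪[L] N := e.symm.toEmbedding.comp j
  refine ⟨ρ', ⟨⟨fun x => relMap_leSymb (L := L) (incl hle ∘ x)⟩, ⟨⟨f.toHom.range, inferInstance⟩,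
    hher N hN ⟨?_, ⟨f.toHom.range.subtype⟩⟩, ⟨f.equivRange.symm⟩⟩,
    sim_iff_of_incl hm hM.le hle hmin (fun _ _ _ => Iff.rfl) h.sim_iff, fun i i' hi h0 => ?_⟩, ?_⟩
  · have : Finite f.toHom.range := Finite.of_equiv _ f.equivRange.toEquiv
    exact FG.of_finite
  · have h₁ := hmin i
    have h₂ := hle i'
    have h₃ := h.eq_zero i i' hi (by omega)
    omega
  · funext r t
    refine propext ⟨fun ⟨h₁, h₂⟩ => ⟨fun i => (h₁ i).trans_le (hle _), h₂⟩,
      fun ⟨h₁, h₂⟩ => ⟨fun i => ?_, h₂⟩⟩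
    have h₃ := h₁ i
    have h₄ := hmin (t i).1
    have h₅ := (t i).2.2
    omega

variable (C) in
/-- The block sizes of the presentations with a given truncation. -/
def sizes (k M : ℕ) (σ : ∀ r : Σ n, L.Relations n, (Fin r.1 → Fin k × Fin M) → Prop) :
    Set (Fin k → ℕ) :=
  {s | ∃ ρ : L.Structure (Blocks s), IsPresentation C s ρ ∧ trunc M ρ = σ}

/-- Members of a class with interval decompositions into at most `k` blocks are classified by the
truncation and the block sizes of their presentation. -/
theorem profile_eq_sum [Finite (Σ n, L.Relations n)] {m M : ℕ}
    [Fintype (∀ r : Σ n, L.Relations n, (Fin r.1 → Fin k × Fin M) → Prop)]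
    (hm : ∀ n, L.Relations n → n ≤ m) (hM : m ≤ M)
    (hC : ∀ S ∈ C, Finite S ∧ IsOrdered L S)
    (h : ∀ S ∈ C, HasIntervalDecompositionLE L S k) (n : ℕ) :
    profile C n = ∑ σ, sumCount (sizes C k M σ) n := by
  classical
  let Z : Finset ((∀ r : Σ n, L.Relations n, (Fin r.1 → Fin k × Fin M) → Prop) × (Fin k → ℕ)) :=
    (Finset.univ ×ˢ Finset.Nat.antidiagonalTuple k n).filter fun p => p.2 ∈ sizes C k M p.1
  have hZ : ∑ σ, sumCount (sizes C k M σ) n = Z.card := by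
    simp only [sumCount, Z, Finset.card_filter, Finset.sum_product]
  have hmemZ : ∀ p, p ∈ Z ↔ ∑ j, p.2 j = n ∧ p.2 ∈ sizes C k M p.1 := fun p => by
    simp [Z, Finset.Nat.mem_antidiagonalTuple]
  rw [hZ, profile, ← Set.ncard_coe_finset]
  have hex : ∀ p ∈ Z, ∃ N ∈ C, ∃ ρ : L.Structure (Blocks p.2),
      IsPresentation C p.2 ρ ∧ trunc M ρ = p.1 ∧ Nonempty (N ≃[L] Blocks p.2) := by
    intro p hp
    obtain ⟨ρ, hρ, hσ⟩ := ((hmemZ p).mp hp).2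
    obtain ⟨N, hN, e⟩ := hρ.exists_mem
    exact ⟨N, hN, ρ, hρ, hσ, e⟩
  choose N hNC hN using hex
  symm
  refine Set.ncard_congr (fun p hp => Quotient.mk equivSetoid (N p hp)) (fun p hp => ?_)
    (fun p q hp hq hpq => ?_) fun q hq => ?_
  · obtain ⟨ρ, -, -, ⟨e⟩⟩ := hN p hp
    refine ⟨N p hp, ⟨hNC p hp, (hC _ (hNC p hp)).1, ?_⟩, rfl⟩
    rw [Nat.card_congr e.toEquiv, Blocks.card_eq]
    exact ((hmemZ p).mp hp).1
  · obtain ⟨ρ, hρ, hσ, ⟨e⟩⟩ := hN p hp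
    obtain ⟨ρ', hρ', hσ', ⟨e'⟩⟩ := hN q hq
    obtain ⟨g⟩ : Nonempty (N p hp ≃[L] N q hq) := Quotient.exact hpq
    obtain ⟨h₁, h₂⟩ := hρ.unique (M := M) hρ' (e'.comp (g.comp e.symm))
    exact Prod.ext (hσ.symm.trans (h₂.trans hσ')) h₁
  · obtain ⟨S, ⟨hS, -, hcard⟩, rfl⟩ := hq
    obtain ⟨s, ρ, hρ, ⟨e⟩⟩ := exists_isPresentation hC hS (h S hS)
    have hp : (trunc M ρ, s) ∈ Z := by
      refine (hmemZ _).mpr ⟨?_, ρ, hρ, rfl⟩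
      rw [← hcard, Nat.card_congr e.toEquiv, Blocks.card_eq]
    refine ⟨(trunc M ρ, s), hp, Quotient.sound ?_⟩
    obtain ⟨ρ', hρ', hσ, ⟨e'⟩⟩ := hN _ hp
    obtain rfl := eq_of_trunc_eq hm hM hρ.sim_iff hρ'.sim_iff hσ.symm
    exact ⟨e.symm.comp e'⟩

theorem exists_polynomial_profile [Finite (Σ n, L.Relations n)] {m : ℕ}
    (hm : ∀ n, L.Relations n → n ≤ m) (hC : ∀ S ∈ C, Finite S ∧ IsOrdered L S)
    (hher : Hereditary C) {l : ℕ} (h : ∀ S ∈ C, HasIntervalDecompositionLE L S (l + 1)) :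
    ∃ P : Polynomial ℚ, P.natDegree ≤ l ∧
      ∀ᶠ n : ℕ in Filter.atTop, (profile C n : ℚ) = P.eval (n : ℚ) := by
  have := Fintype.ofFinite
    (∀ r : Σ n, L.Relations n, (Fin r.1 → Fin (l + 1) × Fin (2 * m + 1)) → Prop)
  choose P hP hev using fun σ : ∀ r : Σ n, L.Relations n,
      (Fin r.1 → Fin (l + 1) × Fin (2 * m + 1)) → Prop =>
    exists_polynomial_sumCount (2 * m + 1) (sizes C (l + 1) (2 * m + 1) σ)
      fun s ⟨ρ, hρ, hσ⟩ s' hle hmin =>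
        let ⟨ρ', hρ', hσ'⟩ := hρ.exists_of_le hm (by omega) hher hle hmin
        ⟨ρ', hρ', hσ'.trans hσ⟩
  refine ⟨∑ σ, P σ, Polynomial.natDegree_sum_le_of_forall_le _ _ fun σ _ => hP σ, ?_⟩
  filter_upwards [Filter.eventually_all.mpr hev] with n hn
  rw [profile_eq_sum hm (M := 2 * m + 1) (by omega) hC h, Polynomial.eval_finsetSum]
  push_cast
  exact Finset.sum_congr rfl fun σ _ => hn σ

end Presentation

end OrderedStr

theorem mainTheorem4 (L : FirstOrder.Language.{u, v}) [L.IsRelational] [L.IsOrdered]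
    [Finite (Σ n, L.Relations n)] :
    ∃ 𝔄 : Set (CategoryTheory.Bundled.{w} L.Structure),
      𝔄.Finite ∧
      𝔄 ⊆ OrderedStr.classD L ∧
      (∀ A ∈ 𝔄, OrderedStr.IsAlmostMultichainable L A) ∧
      (∀ A ∈ 𝔄, ∀ B ∈ 𝔄, A ≠ B → ¬ Nonempty (A ↪[L] B) ∧ ¬ Nonempty (B ↪[L] A)) ∧
      (∀ R ∈ OrderedStr.classD L, ∃ A ∈ 𝔄, Nonempty (A ↪[L] R)) ∧
      ∀ C : Set (CategoryTheory.Bundled.{w} L.Structure),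
        (∀ S ∈ C, Finite S ∧ OrderedStr.IsOrdered L S) →
        FirstOrder.Language.Hereditary C →
          Xor (∃ ℓ : ℕ, ∀ S ∈ C, OrderedStr.HasIntervalDecompositionLE L S (ℓ + 1))
            (∃ A ∈ 𝔄, L.age A ⊆ C) ∧
          ∀ ℓ : ℕ, (∀ S ∈ C, OrderedStr.HasIntervalDecompositionLE L S (ℓ + 1)) →
            ∃ P : Polynomial ℚ, P.natDegree ≤ ℓ ∧
              ∀ᶠ n : ℕ in Filter.atTop, (OrderedStr.profile C n : ℚ) = P.eval (n : ℚ) := by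
  open OrderedStr in
  obtain ⟨m, hm⟩ : ∃ m : ℕ, ∀ n, L.Relations n → n ≤ m := by
    obtain ⟨m, hm⟩ := (Set.finite_range fun r : Σ n, L.Relations n => r.1).bddAbove
    exact ⟨m, fun n r => hm ⟨⟨n, r⟩, rfl⟩⟩
  obtain ⟨𝔄, hsub, hanti, hbelow⟩ := exists_finite_antichain
    (r := fun A B : CategoryTheory.Bundled.{w} L.Structure => Nonempty (A ↪[L] B))
    (fun A => ⟨FirstOrder.Language.Embedding.refl L A⟩) (fun A B D ⟨f⟩ ⟨g⟩ => ⟨g.comp f⟩)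
    (finite_templates L m)
  refine ⟨𝔄, (finite_templates L m).subset hsub, fun A hA => (hsub hA).2,
    fun A hA => isAlmostMultichainable_of_mem_templates (hsub hA),
    fun A hA B hB hAB => ⟨hanti A hA B hB hAB, hanti B hB A hA hAB.symm⟩, fun R hR => ?_,
    fun C hC hher => ⟨?_, fun ℓ hℓ => exists_polynomial_profile hm hC hher hℓ⟩⟩
  · let _ := IsOrdered.linearOrder hR.1
    have := IsOrdered.orderedStructure hR.1
    obtain ⟨a, ha⟩ := exists_isWitSeq_of_mem_classD hm hR
    obtain ⟨T, hT, ⟨f⟩⟩ := ha.exists_template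
    obtain ⟨A, hA, ⟨g⟩⟩ := hbelow T hT
    exact ⟨A, hA, ⟨f.comp g⟩⟩
  · rw [xor_iff_iff_not]
    refine ⟨fun ⟨ℓ, hℓ⟩ ⟨A, hA, hage⟩ => ?_, fun h => ?_⟩
    · obtain ⟨B, hB, hB'⟩ := exists_mem_age_not_hasIntervalDecompositionLE hm (hsub hA).2 (ℓ + 1)
      exact hB' (hℓ B (hage hB))
    · by_contra! hcon
      refine h ?_
      have hk : ∀ k : ℕ, ∃ S ∈ C, ¬ HasIntervalDecompositionLE L S k := fun k => by
        obtain ⟨S, hS, hS'⟩ := hcon k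
        refine ⟨S, hS, fun ⟨P, hP, hPk⟩ => hS' ⟨P, hP, hPk.trans ?_⟩⟩
        exact_mod_cast Nat.le_succ k
      obtain ⟨T, hT, hage⟩ := exists_template_age_subset hm hC hher hk
      obtain ⟨A, hA, ⟨g⟩⟩ := hbelow T hT
      exact ⟨A, hA, fun N hN => hage ⟨hN.1, hN.2.map g.comp⟩⟩
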